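/- Let $\Bbbk$ be a field, $Q=(Q_0,Q_1)$ a locally finite quiver, and $\Bbbk[Q]$ its path category: the objects are the vertices, and $\Bbbk[Q](x,y)$ is the $\Bbbk$-vector space with basis the paths from $x$ to $y$. Let $\Bbbk[Q]^+$ be the ideal generated by all arrows, $\rho\subseteq(\Bbbk[Q]^+)^2$ a set of relations (morphisms), and $A:=\Bbbk[Q,\rho]:=\Bbbk[Q]/\langle\rho\rangle$. Let $G=\langle S\mid R\rangle$ be a monoid given by a monoid presentation, acting on $A$ by an injective homomorphism $G\rightarrowtail\operatorname{End}(A)$ into the monoid of $\Bbbk$-linear endofunctors of $A$. We also allow $G$ to be a monoid with zero, presented as such (relations in $R$ may equate words in $S$ with one another or with $0$). In that case a zero object $0$ is added to $A$, $G$ acts by an injective homomorphism of monoids with zero into the $\Bbbk$-linear endofunctors of $A\cup\{0\}$ fixing $0$ (so $gx=0$ is allowed for $x\in Q_0$), and $0\in G$ acts as the functor with constant value $0$. The orbit category $A/_{1}G$ has the objects of $A$, morphism spaces $(A/_{1}G)(x,y)=\bigoplus_{g\in G}A(gx,y)$ (with $A(0,y)=0$), and the composition of $f=(f_a)_a\colon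 x\to y$ and $f'=(f'_b)_b\colon y\to z$ is $f'f=\bigl(\sum_{ba=m}f'_b\cdot b(f_a)\bigr)_{m\in G}$. For a $\Bbbk$-linear category $\mathcal C$, let $\oplus\mathcal C=\bigoplus_{x,y}\mathcal C(x,y)$, with matrix multiplication. Let $Q'$ be the quiver with vertices $Q'_0=Q_0$, whose arrows are those of $Q$ together with a new arrow $(g,x)\colon x\to gx$ for all $g\in S$ and $x\in Q_0$ with $gx\neq 0$. Read $(g,x)$ as $0$ if $gx=0$. For a word $g=g_t\cdots g_1$ in $S$ with $t\ge 1$ and $x\in Q_0$ let $\pi(g,x):=(g_t,g_{t-1}\cdots g_1x)\cdots(g_2,g_1x)(g_1,x)$, and let $\pi(1,x):=e_x$ (the trivial path) and $\pi(0,x):=0$. Consider the relations 1. $\mu=0$ for all $\mu\in\rho$; 2. $(g,y)\alpha=g(\alpha)(g,x)$ for all arrows $\alpha\colon x\to y$ of $Q$ and all $g\in S$, where $g(\alpha)\in A(gx,gy)$ is represented by any of its lifts to $\Bbbk[Q]$ (the choice does not matter because of (1)), and $g(\alpha)=0$ if $gx=0$ or $gy=0$; 3. $\pi(g,x)=\pi(h,x)$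 for all $(g,h)\in R$ and $x\in Q_0$. Then the category $A/_{1}G$ and the algebra $\oplus(A/_{1}G)$ are presented by $Q'$ with the relations (1)–(3). Explicitly, sending each vertex $x$ to $x$, each arrow $\alpha\colon x\to y$ of $Q$ to the class of $\alpha$ in $A(x,y)$ (the component of $1\in G$), and each new arrow $(g,x)$ to $\mathrm{id}_{gx}\in A(gx,gx)$ (the component of $g$ in $(A/_1G)(x,gx)$) induces an isomorphism of $\Bbbk$-linear categories from $\Bbbk[Q']$ modulo the ideal generated by (1)–(3) onto $A/_{1}G$; and sending $e_x$ to the identity of $x$ and the arrows as above induces an isomorphism of (in general non-unital) $\Bbbk$-algebras from the path algebra $\Bbbk Q'=\oplus\,\Bbbk[Q']$ modulo the two-sided ideal generated by (1)–(3) onto $\oplus(A/_{1}G)$. -/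

import Mathlib

open CategoryTheory

universe uk u v w us ug

namespace SkewMonoid

noncomputable section

/-! ### Ideals and quotients of linear categories -/

section Ideals

/-- A family of sets of morphisms of a category, one for each pair of objects. -/
abbrev MorphSet (C : Type u) [Category.{v} C] := ∀ X Y : C, Set (X ⟶ Y)

variable (k : Type uk) [CommRing k] {C : Type u} [Category.{v} C] [Preadditive C] [Linear k C]

/-- The two-sided ideal of a `k`-linear category generated by a set of morphisms:
the linear combinations of the morphisms `p ≫ f ≫ q` with `f` in the set. -/
def idealSpan (r : MorphSet C) (X Y : C) : Submodule k (X ⟶ Y) :=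
  Submodule.span k {h | ∃ (A B : C) (p : X ⟶ A) (f : A ⟶ B) (q : B ⟶ Y),
    f ∈ r A B ∧ h = p ≫ f ≫ q}

/-- The product of two ideals of a `k`-linear category. -/
def idealMul (I J : ∀ X Y : C, Submodule k (X ⟶ Y)) (X Y : C) : Submodule k (X ⟶ Y) :=
  Submodule.span k {h | ∃ (Z : C) (f : X ⟶ Z) (g : Z ⟶ Y), f ∈ I X Z ∧ g ∈ J Z Y ∧ h = f ≫ g}

lemma comp_mem_idealSpan {r : MorphSet C} {X Y Z : C} (p : X ⟶ Y) {f : Y ⟶ Z}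
    (hf : f ∈ idealSpan k r Y Z) : p ≫ f ∈ idealSpan k r X Z := by
  have : idealSpan k r Y Z ≤ (idealSpan k r X Z).comap (Linear.leftComp k Z p) := by
    refine Submodule.span_le.2 ?_
    rintro _ ⟨A, B, p', f, q, hf, rfl⟩
    exact Submodule.subset_span ⟨A, B, p ≫ p', f, q, hf, by simp⟩
  exact this hf

lemma mem_idealSpan_comp {r : MorphSet C} {X Y Z : C} {f : X ⟶ Y} (q : Y ⟶ Z)
    (hf : f ∈ idealSpan k r X Y) : f ≫ q ∈ idealSpan k r X Z := by
  have : idealSpan k r X Y ≤ (idealSpan k r X Z).comap (Linear.rightComp k X q) := by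
    refine Submodule.span_le.2 ?_
    rintro _ ⟨A, B, p, f, q', hf, rfl⟩
    exact Submodule.subset_span ⟨A, B, p, f, q' ≫ q, hf, by simp⟩
  exact this hf

/-- Two parallel morphisms are identified when they differ by an element of the ideal. -/
def idealRel (r : MorphSet C) : HomRel C := fun X Y f g => f - g ∈ idealSpan k r X Y

instance (r : MorphSet C) : Congruence (idealRel k r) where
  equivalence :=
    { refl := fun f => by simp [idealRel]
      symm := fun {f g} h => by
        have := (idealSpan k r _ _).neg_mem h
        simpa [idealRel] using this
      trans := fun {f g h} h₁ h₂ => by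
        have := (idealSpan k r _ _).add_mem h₁ h₂
        simpa [idealRel] using this }
  comp_left p _ _ h := by
    have := comp_mem_idealSpan k p h
    simpa [idealRel] using this
  comp_right q h := by
    have := mem_idealSpan_comp k q h
    simpa [idealRel] using this

lemma idealRel_add (r : MorphSet C) ⦃X Y : C⦄ (f₁ f₂ g₁ g₂ : X ⟶ Y) (hf : idealRel k r f₁ f₂)
    (hg : idealRel k r g₁ g₂) : idealRel k r (f₁ + g₁) (f₂ + g₂) := by
  have := (idealSpan k r _ _).add_mem hf hg
  rwa [← add_sub_add_comm] at this

/-- The quotient of a `k`-linear category by the ideal generated by a set of morphisms. -/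
abbrev IdealQuotient (r : MorphSet C) := CategoryTheory.Quotient (idealRel k r)

instance (r : MorphSet C) : Preadditive (IdealQuotient k r) :=
  Quotient.preadditive _ (idealRel_add k r)

instance (r : MorphSet C) : (Quotient.functor (idealRel k r)).Additive :=
  Quotient.functor_additive _ (idealRel_add k r)

instance (r : MorphSet C) : Linear k (IdealQuotient k r) :=
  Quotient.linear k _ (fun a X Y f g h => by
    have := (idealSpan k r _ _).smul_mem a h
    rwa [smul_sub] at this)

instance (r : MorphSet C) : (Quotient.functor (idealRel k r)).Linear k :=
  Quotient.linear_functor k _ (fun a X Y f g h => by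
    have := (idealSpan k r _ _).smul_mem a h
    rwa [smul_sub] at this)

end Ideals

/-! ### Path categories -/

section PathCat

variable (k : Type uk) [CommRing k] (V : Type u) [Quiver.{v} V]

/-- The path category `k[Q]` of a quiver: objects are vertices, and the morphisms from `x` to `y`
are the formal `k`-linear combinations of the paths from `x` to `y`. -/
abbrev PathCat := Free k (Paths V)

variable {V}

/-- A vertex as an object of the path category. -/
def PathCat.vertex (x : V) : PathCat k V := (Free.embedding k (Paths V)).obj ((Paths.of V).obj x)

/-- An arrow as a morphism of the path category. -/
def PathCat.arrow {x y : V} (a : x ⟶ y) : PathCat.vertex k x ⟶ PathCat.vertex k y :=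
  (Free.embedding k (Paths V)).map ((Paths.of V).map a)

/-- The set of arrows of a quiver inside its path category. -/
inductive arrows : ∀ X Y : PathCat k V, (X ⟶ Y) → Prop
  | mk {x y : V} (a : x ⟶ y) :
      arrows (PathCat.vertex k x) (PathCat.vertex k y) (PathCat.arrow k a)

variable (V) in
/-- The ideal `k[Q]⁺` generated by all arrows. -/
def arrowIdeal (X Y : PathCat k V) : Submodule k (X ⟶ Y) :=
  idealSpan k (fun X Y => {f | arrows k X Y f}) X Y

variable (V) in
/-- The ideal `(k[Q]⁺)²`. -/
def arrowIdealSq (X Y : PathCat k V) : Submodule k (X ⟶ Y) :=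
  idealMul k (arrowIdeal k V) (arrowIdeal k V) X Y

variable (V) in
/-- A quiver is locally finite if only finitely many arrows start or end at each vertex. -/
def IsLocallyFinite : Prop :=
  ∀ x : V, Finite (Σ y : V, x ⟶ y) ∧ Finite (Σ y : V, y ⟶ x)

variable {D : Type w} [Category.{us} D] [Preadditive D] [Linear k D]

/-- The `k`-linear extension of the map sending a path to the composite of the images of its
arrows. -/
def pathLiftHom (F : V ⥤q D) (X Y : PathCat k V) :
    (X ⟶ Y) →ₗ[k] ((Paths.lift F).obj X ⟶ (Paths.lift F).obj Y) :=
  Finsupp.linearCombination k fun p : (show Paths V from X) ⟶ (show Paths V from Y) =>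
    (Paths.lift F).map p

lemma pathLiftHom_single (F : V ⥤q D) {X Y : Paths V} (p : X ⟶ Y) (c : k) :
    pathLiftHom k F X Y (Finsupp.single p c) = c • (Paths.lift F).map p :=
  Finsupp.linearCombination_single k c p

/-- The `k`-linear functor on the path category determined by the images of vertices and arrows. -/
def pathLift (F : V ⥤q D) : PathCat k V ⥤ D where
  obj X := (Paths.lift F).obj X
  map {X Y} f := pathLiftHom k F X Y f
  map_id X := by
    refine (pathLiftHom_single k F (𝟙 (show Paths V from X)) 1).trans ?_
    rw [one_smul]
    exact (Paths.lift F).map_id X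
  map_comp {X Y Z} f g := by
    have key : (pathLiftHom k F X Z).compRight k ∘ₗ Linear.comp X Y Z =
        (Linear.comp _ _ _).compl₁₂ (pathLiftHom k F X Y) (pathLiftHom k F Y Z) := by
      refine Finsupp.lhom_ext fun p c => ?_
      refine Finsupp.lhom_ext fun q d => ?_
      refine (congrArg (pathLiftHom k F X Z) (Free.single_comp_single k _ p q c d)).trans ?_
      refine (pathLiftHom_single k F _ _).trans ?_
      refine Eq.trans ?_ (congrArg₂ (· ≫ ·) (pathLiftHom_single k F p c)
        (pathLiftHom_single k F q d)).symm
      simp only [mul_smul, Linear.smul_comp, Linear.comp_smul, smul_comm c d]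
      exact congrArg (fun h => d • c • h) ((Paths.lift F).map_comp (X := X) (Y := Y) (Z := Z) p q)
    exact LinearMap.congr_fun (LinearMap.congr_fun key f) g

instance (F : V ⥤q D) : (pathLift k F).Additive where
  map_add {X Y} f g := map_add (pathLiftHom k F X Y) f g

instance (F : V ⥤q D) : (pathLift k F).Linear k where
  map_smul {X Y} f c := map_smul (pathLiftHom k F X Y) c f

end PathCat

/-! ### Adding a zero object -/

/-- The objects of `C` together with one new object `zero`. -/
inductive AddZero (C : Type u)
  | of : C → AddZero C
  | zero : AddZero C

namespace AddZero

variable {C : Type u} [Category.{v} C]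

/-- Morphisms between objects of `C` are those of `C`; all other morphism sets are trivial. -/
def Hom : AddZero C → AddZero C → Type v
  | of X, of Y => X ⟶ Y
  | of _, zero => PUnit
  | zero, _ => PUnit

/-- Composition in the category with the zero object; it is zero as soon as one of the
three objects is the zero object. -/
def comp [Preadditive C] : ∀ {X Y Z : AddZero C}, Hom X Y → Hom Y Z → Hom X Z
  | of X, of Y, of Z, f, g => (show X ⟶ Y from f) ≫ (show Y ⟶ Z from g)
  | of X, zero, of Z, _, _ => (0 : X ⟶ Z)
  | of _, _, zero, _, _ => PUnit.unit
  | zero, _, _, _, _ => PUnit.unit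

variable [Preadditive C]

instance : Category.{v} (AddZero C) where
  Hom := Hom
  id
    | of X => 𝟙 X
    | zero => PUnit.unit
  comp := comp
  id_comp {X Y} f := by
    cases X <;> cases Y <;> first | rfl | exact Category.id_comp (obj := C) f
  comp_id {X Y} f := by
    cases X <;> cases Y <;> first | rfl | exact Category.comp_id (obj := C) f
  assoc {W X Y Z} f g h := by
    cases W <;> cases X <;> cases Y <;> cases Z <;>
      first
      | rfl
      | exact Category.assoc (obj := C) f g h
      | exact Limits.zero_comp (C := C) (f := h)
      | exact (Limits.comp_zero (C := C) (f := f)).symm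

instance homAddCommGroup : ∀ X Y : AddZero C, AddCommGroup (X ⟶ Y)
  | of X, of Y => inferInstanceAs (AddCommGroup (X ⟶ Y))
  | of _, zero => inferInstanceAs (AddCommGroup PUnit)
  | zero, _ => inferInstanceAs (AddCommGroup PUnit)

instance : Preadditive (AddZero C) where
  homGroup := homAddCommGroup
  add_comp X Y Z f g h := by
    cases X <;> cases Y <;> cases Z <;>
      first
      | rfl
      | exact Preadditive.add_comp (C := C) _ _ _ f g h
      | exact (add_zero _).symm
  comp_add X Y Z f g h := by
    cases X <;> cases Y <;> cases Z <;>
      first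
      | rfl
      | exact Preadditive.comp_add (C := C) _ _ _ f g h
      | exact (add_zero _).symm

variable (k : Type uk) [CommRing k] [Linear k C]

instance homModule : ∀ X Y : AddZero C, Module k (X ⟶ Y)
  | of X, of Y => inferInstanceAs (Module k (X ⟶ Y))
  | of _, zero =>
    { smul := fun _ f => f
      one_smul := fun _ => rfl
      mul_smul := fun _ _ _ => rfl
      smul_zero := fun _ => rfl
      smul_add := fun _ _ _ => rfl
      add_smul := fun _ _ _ => rfl
      zero_smul := fun _ => rfl }
  | zero, _ =>
    { smul := fun _ f => f
      one_smul := fun _ => rfl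
      mul_smul := fun _ _ _ => rfl
      smul_zero := fun _ => rfl
      smul_add := fun _ _ _ => rfl
      add_smul := fun _ _ _ => rfl
      zero_smul := fun _ => rfl }

instance : Linear k (AddZero C) where
  homModule := homModule k
  smul_comp X Y Z c f g := by
    cases X <;> cases Y <;> cases Z <;>
      first
      | rfl
      | exact Linear.smul_comp (C := C) _ _ _ c f g
      | exact (smul_zero (M := k) (A := (_ : C) ⟶ _) c).symm
  comp_smul X Y Z f c g := by
    cases X <;> cases Y <;> cases Z <;>
      first
      | rfl
      | exact Linear.comp_smul (C := C) _ _ _ f c g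
      | exact (smul_zero (M := k) (A := (_ : C) ⟶ _) c).symm

instance subsingleton_hom_zero (X : AddZero C) : Subsingleton (X ⟶ zero) := by
  cases X <;> exact inferInstanceAs (Subsingleton PUnit)

instance subsingleton_zero_hom (X : AddZero C) : Subsingleton (zero ⟶ X) :=
  inferInstanceAs (Subsingleton PUnit)

lemma hom_eq {X Y : AddZero C} (h : Y = zero) (f g : X ⟶ Y) : f = g := by
  subst h
  exact Subsingleton.elim f g

variable (C) in
/-- The inclusion of `C` into the category with the zero object added. -/
def incl : C ⥤ AddZero C where
  obj := of
  map f := f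

end AddZero

/-! ### Endofunctors -/

section End

variable (k : Type uk) [CommRing k] (C : Type u) [Category.{v} C] [Preadditive C] [Linear k C]

/-- A `k`-linear endofunctor of `C`. -/
structure LinEnd where
  /-- the underlying functor -/
  functor : C ⥤ C
  additive : functor.Additive
  linear : functor.Linear k

/-- A `k`-linear endofunctor of the category obtained from `C` by adding a zero object,
preserving that zero object: an endofunctor of `C` that may send objects to zero. -/
structure ZEnd where
  /-- the underlying functor -/
  functor : AddZero C ⥤ AddZero C
  additive : functor.Additive
  linear : functor.Linear k
  obj_zero : functor.obj AddZero.zero = AddZero.zero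

variable {k C}

@[ext] lemma LinEnd.ext {F G : LinEnd k C} (h : F.functor = G.functor) : F = G := by
  cases F; cases G; cases h; rfl

@[ext] lemma ZEnd.ext {F G : ZEnd k C} (h : F.functor = G.functor) : F = G := by
  cases F; cases G; cases h; rfl

attribute [instance] LinEnd.additive LinEnd.linear ZEnd.additive ZEnd.linear

/-- The multiplication is `(F * G) x = F (G x)`. -/
instance : Monoid (LinEnd k C) where
  mul F G := ⟨G.functor ⋙ F.functor, inferInstance, inferInstance⟩
  one := ⟨𝟭 C, inferInstance, inferInstance⟩
  mul_assoc _ _ _ := rfl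
  one_mul _ := rfl
  mul_one _ := rfl

variable (k C) in
/-- The functor sending everything to the zero object. -/
def ZEnd.zeroFunctor : AddZero C ⥤ AddZero C where
  obj _ := AddZero.zero
  map _ := 𝟙 _

/-- The multiplication is `(F * G) x = F (G x)`, and `0` sends everything to the zero object. -/
instance : MonoidWithZero (ZEnd k C) where
  mul F G := ⟨G.functor ⋙ F.functor, inferInstance, inferInstance,
    (congrArg F.functor.obj G.obj_zero).trans F.obj_zero⟩
  one := ⟨𝟭 _, inferInstance, inferInstance, rfl⟩
  mul_assoc _ _ _ := rfl
  one_mul _ := rfl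
  mul_one _ := rfl
  zero := ⟨ZEnd.zeroFunctor C, ⟨AddZero.hom_eq rfl _ _⟩, ⟨fun _ _ => AddZero.hom_eq rfl _ _⟩, rfl⟩
  zero_mul _ := rfl
  mul_zero F := by
    apply ZEnd.ext
    refine CategoryTheory.Functor.ext (fun X => F.obj_zero) (fun X Y f => ?_)
    exact AddZero.hom_eq F.obj_zero _ _

/-- The extension of an endofunctor of `C` by `0 ↦ 0`. -/
def LinEnd.extendFunctor (F : C ⥤ C) [F.Additive] : AddZero C ⥤ AddZero C where
  obj
    | .of X => .of (F.obj X)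
    | .zero => .zero
  map {X Y} f := match X, Y, f with
    | .of _, .of _, f => F.map f
    | .of _, .zero, _ => PUnit.unit
    | .zero, _, _ => PUnit.unit
  map_id X := by
    cases X
    · exact F.map_id _
    · rfl
  map_comp {X Y Z} f g := by
    cases X <;> cases Y <;> cases Z <;>
      first
      | rfl
      | exact F.map_comp (X := _) (Y := _) (Z := _) f g
      | exact F.map_zero _ _

instance (F : C ⥤ C) [F.Additive] : (LinEnd.extendFunctor F).Additive where
  map_add {X Y} f g := by
    cases X <;> cases Y <;> first | rfl | exact F.map_add (f := f) (g := g)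

instance (F : C ⥤ C) [F.Additive] [F.Linear k] : (LinEnd.extendFunctor F).Linear k where
  map_smul {X Y} f c := by
    cases X <;> cases Y <;> first | rfl | exact F.map_smul (f := f) c

variable (k C) in
/-- Every endofunctor of `C` extends to the category with the zero object added by `0 ↦ 0`. -/
def LinEnd.toZEnd : LinEnd k C →* ZEnd k C where
  toFun F := ⟨LinEnd.extendFunctor F.functor, inferInstance, inferInstance, rfl⟩
  map_one' := by
    apply ZEnd.ext
    refine CategoryTheory.Functor.ext (fun X => by cases X <;> rfl) (fun X Y f => ?_)
    cases X <;> cases Y <;> 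
      first
      | rfl
      | exact ((Category.id_comp _).trans (Category.comp_id _)).symm
  map_mul' F G := by
    apply ZEnd.ext
    refine CategoryTheory.Functor.ext (fun X => by cases X <;> rfl) (fun X Y f => ?_)
    cases X <;> cases Y <;> 
      first
      | rfl
      | exact ((Category.id_comp _).trans (Category.comp_id _)).symm

end End

/-! ### The orbit category -/

section Orbit

variable {k : Type uk} [CommRing k] {C : Type u} [Category.{v} C] [Preadditive C] [Linear k C]
  {G : Type ug} [Monoid G]

/-- The objects of the (first) orbit category of `C` by `G`: those of `C`. -/
structure Orbit (φ : G →* ZEnd k C) where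
  /-- the underlying object -/
  as : C

namespace Orbit

variable {φ : G →* ZEnd k C}

/-- The object `g x`, which may be zero. -/
abbrev act (φ : G →* ZEnd k C) (g : G) (X : C) : AddZero C := (φ g).functor.obj (.of X)

variable (φ) in
lemma act_mul (h g : G) (X : C) :
    act φ (h * g) X = (φ h).functor.obj (act φ g X) := by
  rw [act, map_mul]; rfl

variable (φ) in
lemma act_one (X : C) : act φ 1 X = .of X := by
  rw [act, map_one]; rfl

/-- Morphisms from `x` to `y` in the orbit category: the direct sum over `g` in `G` of the
morphisms from `g x` to `y`. -/
abbrev Hom (X Y : Orbit φ) := DirectSum G fun g => (act φ g X.as ⟶ AddZero.of Y.as)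

open Classical in
/-- The element of the direct sum concentrated in the component of `g`. -/
def single {X Y : Orbit φ} (g : G) : (act φ g X.as ⟶ AddZero.of Y.as) →+ Hom X Y :=
  DirectSum.of (fun g => (act φ g X.as ⟶ AddZero.of Y.as)) g

/-- For `f : g x ⟶ y` and `f' : h y ⟶ z`, the morphism `f' ∘ h(f) : (h g) x ⟶ z`. -/
def comp₁ {X Y Z : C} (g h : G) (f : act φ g X ⟶ .of Y) (f' : act φ h Y ⟶ .of Z) :
    act φ (h * g) X ⟶ .of Z :=
  eqToHom (act_mul φ h g X) ≫ (φ h).functor.map f ≫ f'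

/-- The map `comp₁` as a biadditive map. -/
def comp₁Hom (X Y Z : Orbit φ) (g h : G) :
    (act φ g X.as ⟶ .of Y.as) →+ (act φ h Y.as ⟶ .of Z.as) →+ Hom X Z :=
  AddMonoidHom.mk' (fun f => AddMonoidHom.mk'
      (fun f' => single (X := X) (Y := Z) (h * g) (comp₁ g h f f'))
      (fun a b => by simp [comp₁]))
    (fun a b => by
      ext1 x
      simp [comp₁])

open Classical in
/-- The biadditive extension of `comp₁`: the component at `m` of the composite of `(f_g)` and
`(f'_h)` is the sum over `h * g = m` of `f'_h ∘ h(f_g)`. -/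
def comp (X Y Z : Orbit φ) : Hom X Y →+ Hom Y Z →+ Hom X Z :=
  DirectSum.toAddMonoid fun g => AddMonoidHom.flip <| DirectSum.toAddMonoid fun h =>
    (comp₁Hom X Y Z g h).flip

lemma comp_single {X Y Z : Orbit φ} (g h : G) (f : act φ g X.as ⟶ .of Y.as)
    (f' : act φ h Y.as ⟶ .of Z.as) :
    comp X Y Z (single g f) (single h f') = single (h * g) (comp₁ g h f f') := by
  classical
  unfold comp single
  rw [DirectSum.toAddMonoid_of, AddMonoidHom.flip_apply, DirectSum.toAddMonoid_of]
  rfl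

lemma hom_ind {X Y : Orbit φ} {p : Hom X Y → Prop} (zero : p 0)
    (single : ∀ g f, p (single g f)) (add : ∀ a b, p a → p b → p (a + b)) (a : Hom X Y) : p a := by
  classical
  exact DirectSum.induction_on a zero single add

lemma single_congr {X Y : Orbit φ} {g h : G} (e : g = h) (f : act φ g X.as ⟶ .of Y.as)
    (f' : act φ h X.as ⟶ .of Y.as) (H : f = eqToHom (by rw [e]) ≫ f') :
    (single g f : Hom X Y) = single h f' := by
  subst e
  simp [H]

/-- The identity of `x` lies in the component of `1`. -/
def id (X : Orbit φ) : Hom X X := single 1 (eqToHom (act_one φ X.as))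

instance : Category (Orbit φ) where
  Hom := Hom
  id := id
  comp {X Y Z} f g := comp X Y Z f g
  id_comp {X Y} f := by
    refine hom_ind (p := fun f => comp X X Y (id X) f = f) (by simp) (fun g f => ?_)
      (fun a b ha hb => by rw [map_add, ha, hb]) f
    rw [id, comp_single]
    refine single_congr (mul_one g) _ _ ?_
    simp [comp₁, eqToHom_map]
  comp_id {X Y} f := by
    refine hom_ind (p := fun f => comp X Y Y f (id Y) = f) (by simp) (fun g f => ?_)
      (fun a b ha hb => by rw [map_add, AddMonoidHom.add_apply, ha, hb]) f
    rw [id, comp_single]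
    refine single_congr (one_mul g) _ _ ?_
    have h : (φ 1).functor = 𝟭 _ := by rw [map_one]; rfl
    simp [comp₁, Functor.congr_hom h f]
  assoc {W X Y Z} f g h := by
    refine hom_ind (p := fun f => comp W Y Z (comp W X Y f g) h = comp W X Z f (comp X Y Z g h))
      (by simp) (fun a f => ?_) (fun a b ha hb => by simp [ha, hb]) f
    refine hom_ind (p := fun g => comp W Y Z (comp W X Y (single a f) g) h =
      comp W X Z (single a f) (comp X Y Z g h))
      (by simp) (fun b g => ?_) (fun a b ha hb => by simp [ha, hb]) g
    refine hom_ind (p := fun h => comp W Y Z (comp W X Y (single a f) (single b g)) h =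
      comp W X Z (single a f) (comp X Y Z (single b g) h))
      (by simp) (fun c h => ?_) (fun a b ha hb => by simp [ha, hb]) h
    rw [comp_single, comp_single, comp_single, comp_single]
    refine single_congr (mul_assoc c b a).symm _ _ ?_
    have e : (φ (c * b)).functor = (φ b).functor ⋙ (φ c).functor := by rw [map_mul]; rfl
    simp [comp₁, Functor.congr_hom e f, eqToHom_map]

instance : Preadditive (Orbit φ) where
  homGroup X Y := inferInstanceAs (AddCommGroup (Hom X Y))
  add_comp X Y Z f f' g := DFunLike.congr_fun ((comp X Y Z).map_add f f') g
  comp_add X Y Z f g g' := (comp X Y Z f).map_add g g'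

lemma single_smul {X Y : Orbit φ} (c : k) (g : G) (f : act φ g X.as ⟶ .of Y.as) :
    (single g (c • f) : Hom X Y) = c • (single g f : Hom X Y) := by
  classical
  exact (DirectSum.lof k G (fun g => (act φ g X.as ⟶ AddZero.of Y.as)) g).map_smul c f

lemma smul_comp' {X Y Z : Orbit φ} (c : k) (f : Hom X Y) (g : Hom Y Z) :
    comp X Y Z (c • f) g = c • comp X Y Z f g := by
  refine hom_ind (p := fun f => comp X Y Z (c • f) g = c • comp X Y Z f g)
    (by simp) (fun a f => ?_) (fun a b ha hb => by simp [ha, hb]) f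
  refine hom_ind (p := fun g => comp X Y Z (c • single a f) g = c • comp X Y Z (single a f) g)
    (by simp) (fun b g => ?_) (fun a b ha hb => by simp [ha, hb]) g
  rw [← single_smul, comp_single, comp_single, ← single_smul]
  simp [comp₁]

lemma comp_smul' {X Y Z : Orbit φ} (c : k) (f : Hom X Y) (g : Hom Y Z) :
    comp X Y Z f (c • g) = c • comp X Y Z f g := by
  refine hom_ind (p := fun f => comp X Y Z f (c • g) = c • comp X Y Z f g)
    (by simp) (fun a f => ?_) (fun a b ha hb => by simp [ha, hb]) f
  refine hom_ind (p := fun g => comp X Y Z (single a f) (c • g) = c • comp X Y Z (single a f) g)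
    (by simp) (fun b g => ?_) (fun a b ha hb => by simp [ha, hb]) g
  rw [← single_smul, comp_single, comp_single, ← single_smul]
  simp [comp₁]

instance : Linear k (Orbit φ) where
  homModule X Y := inferInstanceAs (Module k (Hom X Y))
  smul_comp _ _ _ c f g := smul_comp' c f g
  comp_smul _ _ _ f c g := comp_smul' c f g

end Orbit

end Orbit
/-! ### The algebra of a category -/

section CatAlg

/-- The algebra `⊕ C` of a linear category: families of morphisms, indexed by pairs of objects,
with finitely many nonzero entries. It has no unit in general. -/
def CatAlg (C : Type u) [Category.{v} C] [Preadditive C] :=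
  DirectSum (C × C) fun p => (p.1 ⟶ p.2)

namespace CatAlg

variable {C : Type u} [Category.{v} C] [Preadditive C]

instance : AddCommGroup (CatAlg C) :=
  inferInstanceAs (AddCommGroup (DirectSum (C × C) fun p => (p.1 ⟶ p.2)))

instance (k : Type uk) [CommRing k] [Linear k C] : Module k (CatAlg C) :=
  inferInstanceAs (Module k (DirectSum (C × C) fun p => (p.1 ⟶ p.2)))

open Classical in
/-- The matrix whose only entry is `f : X ⟶ Y`, at the position `(Y, X)`. -/
def single (X Y : C) : (X ⟶ Y) →+ CatAlg C :=
  DirectSum.of (fun p : C × C => (p.1 ⟶ p.2)) (X, Y)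

open Classical in
/-- The product of two matrices with a single entry: `g * f` is the matrix of the composite of
`f` followed by `g` if these are composable, and `0` otherwise. -/
def mulSingle (p q : C × C) : (p.1 ⟶ p.2) →+ (q.1 ⟶ q.2) →+ CatAlg C :=
  if h : q.2 = p.1 then
    AddMonoidHom.mk' (fun g => AddMonoidHom.mk' (fun f => single q.1 p.2 (f ≫ eqToHom h ≫ g))
      (fun a b => by simp))
    (fun a b => by
      ext1 x
      simp)
  else 0

open Classical in
/-- Matrix multiplication. -/
def mulHom : CatAlg C →+ CatAlg C →+ CatAlg C :=
  DirectSum.toAddMonoid fun p => AddMonoidHom.flip <| DirectSum.toAddMonoid fun q =>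
    (mulSingle p q).flip

instance : Mul (CatAlg C) := ⟨fun a b => mulHom a b⟩

lemma single_mul_single (X Y X' Y' : C) (g : X ⟶ Y) (f : X' ⟶ Y') :
    single X Y g * single X' Y' f = mulSingle (X, Y) (X', Y') g f := by
  classical
  refine (DFunLike.congr_fun (DirectSum.toAddMonoid_of (fun p : C × C =>
    AddMonoidHom.flip <| DirectSum.toAddMonoid fun q => (mulSingle p q).flip) (X, Y) g)
    (single X' Y' f)).trans ?_
  exact DFunLike.congr_fun (DirectSum.toAddMonoid_of
    (fun q : C × C => (mulSingle (X, Y) q).flip) (X', Y') f) g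

lemma single_mul_single_same {X Y Z : C} (g : Y ⟶ Z) (f : X ⟶ Y) :
    single Y Z g * single X Y f = single X Z (f ≫ g) := by
  rw [single_mul_single, mulSingle, dif_pos rfl]
  simp

lemma single_mul_single_ne {X Y X' Y' : C} (h : Y' ≠ X) (g : X ⟶ Y) (f : X' ⟶ Y') :
    single X Y g * single X' Y' f = 0 := by
  rw [single_mul_single, mulSingle, dif_neg h]
  rfl

lemma ind {p : CatAlg C → Prop} (zero : p 0) (single : ∀ X Y f, p (single X Y f))
    (add : ∀ a b, p a → p b → p (a + b)) (a : CatAlg C) : p a := by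
  classical
  exact DirectSum.induction_on a zero (fun _ _ => single _ _ _) add

instance : NonUnitalRing (CatAlg C) :=
  { (inferInstance : AddCommGroup (CatAlg C)), (inferInstance : Mul (CatAlg C)) with
    left_distrib := fun a b c => (mulHom a).map_add b c
    right_distrib := fun a b c => DFunLike.congr_fun (mulHom.map_add a b) c
    zero_mul := fun a => DFunLike.congr_fun mulHom.map_zero a
    mul_zero := fun a => (mulHom a).map_zero
    mul_assoc := fun a b c => by
      have zm : ∀ a : CatAlg C, 0 * a = 0 := fun a => DFunLike.congr_fun mulHom.map_zero a
      have mz : ∀ a : CatAlg C, a * 0 = 0 := fun a => (mulHom a).map_zero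
      have am : ∀ a b c : CatAlg C, (a + b) * c = a * c + b * c :=
        fun a b c => DFunLike.congr_fun (mulHom.map_add a b) c
      have ma : ∀ a b c : CatAlg C, a * (b + c) = a * b + a * c :=
        fun a b c => (mulHom a).map_add b c
      refine ind (p := fun a => a * b * c = a * (b * c)) (by simp only [zm])
        (fun X Y f => ?_) (fun a b ha hb => by simp only [am, ha, hb]) a
      refine ind (p := fun b => single X Y f * b * c = single X Y f * (b * c))
        (by simp only [zm, mz])
        (fun X' Y' f' => ?_) (fun a b ha hb => by simp only [am, ma, ha, hb]) b
      refine ind (p := fun c => single X Y f * single X' Y' f' * c =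
          single X Y f * (single X' Y' f' * c)) (by simp only [mz])
        (fun X'' Y'' f'' => ?_) (fun a b ha hb => by simp only [ma, ha, hb]) c
      by_cases h : Y' = X
      · subst h
        by_cases h' : Y'' = X'
        · subst h'
          simp only [single_mul_single_same, Category.assoc]
        · rw [single_mul_single_same, single_mul_single_ne h', single_mul_single_ne h', mz]
      · rw [single_mul_single_ne h, zm]
        by_cases h' : Y'' = X'
        · subst h'
          rw [single_mul_single_same, single_mul_single_ne h]
        · rw [single_mul_single_ne h', mz] }

end CatAlg

end CatAlg

/-! ### Presentations by quivers with relations -/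

section Presentation

variable (k : Type uk) [CommRing k] {V : Type u} [Quiver.{v} V]
  {D : Type w} [Category.{us} D] [Preadditive D] [Linear k D]

/-- The category `D` is presented by the quiver `V` with relations `r`, where vertices and
arrows are interpreted in `D` by `F`: the functor `k[V] ⥤ D` given by `F` induces an isomorphism of
`k`-linear categories from `k[V]/⟨r⟩` to `D`. -/
def IsCategoryPresentation (F : V ⥤q D) (r : MorphSet (PathCat k V)) : Prop :=
  ∃ (Φ : IdealQuotient k r ⥤ D) (Θ : D ⥤ IdealQuotient k r),
    Φ.Additive ∧ Φ.Linear k ∧ Quotient.functor (idealRel k r) ⋙ Φ = pathLift k F ∧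
      Φ ⋙ Θ = 𝟭 _ ∧ Θ ⋙ Φ = 𝟭 _

/-- The two-sided ideal of the path algebra `⊕ k[V]` generated by a set of relations. -/
def pathAlgIdeal (r : MorphSet (PathCat k V)) : TwoSidedIdeal (CatAlg (PathCat k V)) :=
  TwoSidedIdeal.span {a | ∃ (X Y : PathCat k V) (f : X ⟶ Y), f ∈ r X Y ∧ a = CatAlg.single X Y f}

/-- The algebra `⊕ D` is presented by the quiver `V` with relations `r`, where vertices and
arrows are interpreted in `D` by `F`: there is an isomorphism of `k`-algebras from the quotient of
the path algebra by the ideal generated by `r` to `⊕ D`, given by `F` on vertices and arrows. -/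
def IsAlgebraPresentation (F : V ⥤q D) (r : MorphSet (PathCat k V)) : Prop :=
  ∃ e : (pathAlgIdeal k r).ringCon.Quotient ≃+* CatAlg D,
    (∀ (c : k) (a : CatAlg (PathCat k V)),
      e (RingCon.toQuotient (c • a)) = c • e (RingCon.toQuotient a)) ∧
    (∀ x : V, e (RingCon.toQuotient (CatAlg.single _ _ (𝟙 (PathCat.vertex k x)))) =
      CatAlg.single _ _ (𝟙 (F.obj x))) ∧
    ∀ (x y : V) (a : x ⟶ y),
      e (RingCon.toQuotient (CatAlg.single _ _ (PathCat.arrow k a))) =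
        CatAlg.single _ _ (F.map a)

end Presentation

/-! ### Monoid presentations -/

section Monoid

variable {S : Type us} {G : Type ug}

/-- `G = ⟨S | R⟩` as a monoid. -/
def IsMonoidPresentation [Monoid G] (gen : S → G) (R : Set (FreeMonoid S × FreeMonoid S)) : Prop :=
  Function.Surjective (FreeMonoid.lift gen) ∧
    Con.ker (FreeMonoid.lift gen) = conGen fun a b => (a, b) ∈ R

/-- `G = ⟨S | R⟩` as a monoid with zero: the relations are between words or between a word
and `0`. -/
def IsMonoidWithZeroPresentation [MonoidWithZero G] (gen : S → G)
    (R : Set (WithZero (FreeMonoid S) × WithZero (FreeMonoid S))) : Prop :=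
  Function.Surjective (WithZero.lift' (FreeMonoid.lift gen)) ∧
    Con.ker (WithZero.lift' (FreeMonoid.lift gen)) = conGen fun a b => (a, b) ∈ R

end Monoid

/-! ### The quiver with relations of the orbit category -/

section Skew

variable {k : Type uk} [CommRing k] {V : Type u} [Quiver.{v} V]

/-- A vertex as an object of `k[Q, ρ] = k[Q]/⟨ρ⟩`. -/
def presVertex (ρ : MorphSet (PathCat k V)) (x : V) : IdealQuotient k ρ :=
  (Quotient.functor (idealRel k ρ)).obj (PathCat.vertex k x)

/-- The vertex underlying an object of `k[Q, ρ]`. -/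
def toVertex (ρ : MorphSet (PathCat k V)) (X : IdealQuotient k ρ) : V := X.as

lemma presVertex_toVertex (ρ : MorphSet (PathCat k V)) (X : IdealQuotient k ρ) :
    presVertex ρ (toVertex ρ X) = X := rfl

lemma toVertex_presVertex (ρ : MorphSet (PathCat k V)) (x : V) :
    toVertex ρ (presVertex ρ x) = x := rfl

/-- An arrow as a morphism of `k[Q, ρ]`. -/
def presArrow (ρ : MorphSet (PathCat k V)) {x y : V} (a : x ⟶ y) :
    presVertex ρ x ⟶ presVertex ρ y :=
  (Quotient.functor (idealRel k ρ)).map (PathCat.arrow k a)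

variable {ρ : MorphSet (PathCat k V)} {S : Type us}

/-- The vertices of the quiver `Q'`, where each `s : S` acts on `k[Q, ρ]` by `t s`: those of `Q`. -/
structure SkewQuiver (t : S → ZEnd k (IdealQuotient k ρ)) where
  /-- the underlying vertex of `Q` -/
  vertex : V

variable (t : S → ZEnd k (IdealQuotient k ρ))

/-- The object `s x`, which may be zero. -/
abbrev sAct (s : S) (x : V) : AddZero (IdealQuotient k ρ) :=
  (t s).functor.obj (.of (presVertex ρ x))

/-- The arrows of `Q'` from `x` to `y` are the arrows of `Q` from `x` to `y` and a new
arrow `(s, x)` for each `s : S` with `s x = y`. -/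
instance : Quiver (SkewQuiver t) where
  Hom x y := (x.vertex ⟶ y.vertex) ⊕ {s : S // sAct t s x.vertex = .of (presVertex ρ y.vertex)}

/-- A vertex of `Q` as a vertex of `Q'` in the path category of `Q'`. -/
abbrev skewVertex (x : V) : PathCat k (SkewQuiver t) := PathCat.vertex k ⟨x⟩

/-- An arrow of `Q` as a morphism of `k[Q']`. -/
def oldArrow {x y : V} (α : x ⟶ y) : skewVertex t x ⟶ skewVertex t y :=
  PathCat.arrow k (V := SkewQuiver t) (x := ⟨x⟩) (y := ⟨y⟩) (Sum.inl α)

/-- The inclusion of `Q` into `k[Q']`. -/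
def oldPrefunctor : V ⥤q PathCat k (SkewQuiver t) where
  obj x := skewVertex t x
  map α := oldArrow t α

/-- The inclusion of `k[Q]` into `k[Q']`. -/
def oldInclusion : PathCat k V ⥤ PathCat k (SkewQuiver t) := pathLift k (oldPrefunctor t)

/-- A morphism of `k[Q]` as a morphism of `k[Q']`. -/
def oldMor {x y : V} (μ : PathCat.vertex k x ⟶ PathCat.vertex k y) :
    skewVertex t x ⟶ skewVertex t y :=
  (oldInclusion t).map μ

/-- The new arrow `(s, x) : x ⟶ y`, where `y = s x`, in `k[Q']`. -/
def newArrow (s : S) {x y : V} (h : sAct t s x = .of (presVertex ρ y)) :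
    skewVertex t x ⟶ skewVertex t y :=
  PathCat.arrow k (V := SkewQuiver t) (x := ⟨x⟩) (y := ⟨y⟩) (Sum.inr ⟨s, h⟩)

open Classical in
/-- For a list `[g₁, …, gₗ]` of elements of `S` and vertices `x`, `y`, the path
`(gₗ, gₗ₋₁ ⋯ g₁ x) ⋯ (g₂, g₁ x) (g₁, x)` (the arrow `(g₁, x)` comes first) if it exists and ends
at `y`, and `0` otherwise. -/
def piList : List S → ∀ x y : V, skewVertex t x ⟶ skewVertex t y
  | [], x, y => if h : x = y then eqToHom (by rw [h]) else 0
  | s :: l, x, y =>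
    match h : sAct t s x with
    | .of Z => newArrow t s (y := toVertex ρ Z) h ≫ piList l (toVertex ρ Z) y
    | .zero => 0

/-- The component at `y` of `π(g, x)`, for `g` a word in `S` or `0`: this is `π(g, x)` if `g x = y`
and `0` otherwise, where `π(gₗ ⋯ g₁, x) = (gₗ, gₗ₋₁ ⋯ g₁ x) ⋯ (g₂, g₁ x) (g₁, x)`, `π(1, x)` is the
trivial path and `π(0, x) = 0`. -/
def piWord (g : WithZero (FreeMonoid S)) (x y : V) : skewVertex t x ⟶ skewVertex t y :=
  WithZero.recZeroCoe (motive := fun _ => (skewVertex t x ⟶ skewVertex t y)) 0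
    (fun w => piList t (FreeMonoid.toList w).reverse x y) g

/-- The relations on `Q'`. In the skew monoid relations, `μ` is any representative in `k[Q]` of
the morphism `s(α)` of `k[Q, ρ]`, and an arrow `(s, x)` with `s x = 0` is read as `0`. -/
inductive skewRel (R : Set (WithZero (FreeMonoid S) × WithZero (FreeMonoid S))) :
    ∀ X Y : PathCat k (SkewQuiver t), (X ⟶ Y) → Prop
  /-- the relations of `Q` -/
  | old {X Y : PathCat k V} (μ : X ⟶ Y) (hμ : μ ∈ ρ X Y) :
      skewRel R _ _ ((oldInclusion t).map μ)
  /-- `(s, y) α = s(α) (s, x)` -/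
  | skew {x y : V} (α : x ⟶ y) (s : S) {x' y' : V}
      (hx : sAct t s x = .of (presVertex ρ x')) (hy : sAct t s y = .of (presVertex ρ y'))
      (μ : PathCat.vertex k x' ⟶ PathCat.vertex k y')
      (hμ : (t s).functor.map ((AddZero.incl _).map (presArrow ρ α)) =
        eqToHom hx ≫ (AddZero.incl _).map ((Quotient.functor (idealRel k ρ)).map μ) ≫
          eqToHom hy.symm) :
      skewRel R (skewVertex t x) (skewVertex t y') (oldArrow t α ≫ newArrow t s hy -
        newArrow t s hx ≫ oldMor t μ)
  /-- `(s, y) α = 0` if `s x = 0` -/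
  | skewZero {x y : V} (α : x ⟶ y) (s : S) {y' : V}
      (hx : sAct t s x = .zero) (hy : sAct t s y = .of (presVertex ρ y')) :
      skewRel R (skewVertex t x) (skewVertex t y') (oldArrow t α ≫ newArrow t s hy)
  /-- `π(g, x) = π(h, x)` -/
  | monoid {g h : WithZero (FreeMonoid S)} (hgh : (g, h) ∈ R) (x y : V) :
      skewRel R _ _ (piWord t g x y - piWord t h x y)

variable {G : Type ug} [Monoid G]

/-- The interpretation of `Q'` in the orbit category: an arrow `α : x ⟶ y` of `Q` goes to `α` in the
component of `1`, and the new arrow `(s, x)` goes to the identity of `s x` in the component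
of `s`. -/
def skewInterp (φ : G →* ZEnd k (IdealQuotient k ρ)) (gen : S → G) :
    SkewQuiver (fun s => φ (gen s)) ⥤q Orbit φ where
  obj x := ⟨presVertex ρ x.vertex⟩
  map {x y}
    | .inl α => Orbit.single (X := ⟨presVertex ρ x.vertex⟩) (Y := ⟨presVertex ρ y.vertex⟩) 1
        (eqToHom (Orbit.act_one φ _) ≫ (AddZero.incl _).map (presArrow ρ α))
    | .inr s => Orbit.single (X := ⟨presVertex ρ x.vertex⟩) (Y := ⟨presVertex ρ y.vertex⟩)
        (gen s.1) (eqToHom s.2)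

/-- The orbit category `A /₁ G` and the algebra `⊕ (A /₁ G)`, where `A = k[Q, ρ]`, are presented by
the quiver `Q'` with its three kinds of relations. -/
def OrbitPresented (φ : G →* ZEnd k (IdealQuotient k ρ)) (gen : S → G)
    (R : Set (WithZero (FreeMonoid S) × WithZero (FreeMonoid S))) : Prop :=
  IsCategoryPresentation k (skewInterp φ gen)
      (fun X Y => {f | skewRel (fun s => φ (gen s)) R X Y f}) ∧
    IsAlgebraPresentation k (skewInterp φ gen)
      (fun X Y => {f | skewRel (fun s => φ (gen s)) R X Y f})

end Skew
end
end SkewMonoid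

open SkewMonoid

namespace SkewMonoid

noncomputable section

/-! ### Path categories and quotients by ideals -/

section PathCat

variable {k : Type uk} [CommRing k] {V : Type u} [Quiver.{v} V]
  {D : Type w} [Category.{us} D] [Preadditive D] [Linear k D]

/-! Write `A = k[Q, ρ]`, and let `F` be the functor `skewFunctor` from `k[Q']` to the orbit
category. It is bijective on objects. The theorem therefore comes down to two facts: `F` is full,
and its kernel is the ideal generated by the relations. `isCategoryPresentation_of_kernel` and
`isAlgebraPresentation_of_kernel` turn them into the two presentations.

The relations lie in the kernel (`skewFunctor_map_eq_zero`). Composing in the orbit category with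
the component of `g` twists the preceding morphism by `g`, which is relation (2). The path `π(w, x)`
goes to an identity in the component of the value of `w`, so only that value matters, which is
relation (3). Fullness (`skewFunctor_full`) holds because `f : g x ⟶ y` in the component of `g` is
the image of `π(w, x)` followed by a lift of `f`, where `w` is any word for `g`.

For the converse inclusion, choose a word `rep g` for each `g`. Let `orbitToSkew` send `f` in the
component of `g` to the class of `π(rep g, x)` followed by `f`. Applying it after `F` gives the
projection modulo the relations (`orbitToSkew_skewFunctor`), so whatever `F` kills is in the ideal.
The proof appends one arrow at a time to a path. An arrow of `Q` is absorbed into `f`. A new arrow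
needs two inputs. The first is that the skew relation holds for all morphisms of `A` and not only
for arrows (`isSkew`), so that the new arrow can be moved to the left of `f`. The second is that
words with equal value have equal classes: agreement in action and in classes of paths is a
congruence (`wordCon`), and it contains `R`, hence the whole kernel of the presentation.

Everything is done for actions on `A ∪ {0}`. An action by endofunctors of `A` is included through
`LinEnd.toZEnd`, and `orbitPresented_of_rep` serves both kinds of monoid. -/

/-- Induction on morphisms of a path category. -/
lemma PathCat.hom_ind {p : ∀ X Y : PathCat k V, (X ⟶ Y) → Prop}
    (zero : ∀ X Y, p X Y 0) (add : ∀ X Y f g, p X Y f → p X Y g → p X Y (f + g))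
    (smul : ∀ X Y (c : k) f, p X Y f → p X Y (c • f))
    (id : ∀ x : V, p _ _ (𝟙 (PathCat.vertex k x)))
    (comp : ∀ (x y z : V) (f : PathCat.vertex k x ⟶ PathCat.vertex k y) (a : y ⟶ z),
      p _ _ f → p _ _ (f ≫ PathCat.arrow k a)) {X Y : PathCat k V} (f : X ⟶ Y) : p X Y f := by
  have key : ∀ {x y : V} (q : Quiver.Path x y),
      p (PathCat.vertex k x) (PathCat.vertex k y)
        ((Free.embedding k (Paths V)).map (X := x) (Y := y) q) := by
    intro x y q
    induction q with
    | nil => exact id x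
    | cons q a ih =>
      have := comp _ _ _ _ a ih
      exact (congrArg (p (PathCat.vertex k x) (PathCat.vertex k _))
        ((Free.embedding k (Paths V)).map_comp (X := (x : V)) q ((Paths.of V).map a))).mpr this
  refine Finsupp.induction_linear (motive := fun f => p X Y f) f (zero X Y) (add X Y)
    fun q c => ?_
  have := smul _ _ c _ (key (x := X) (y := Y) q)
  have e : (Finsupp.single q c : X ⟶ Y) =
      c • (Free.embedding k (Paths V)).map (X := (X : V)) (Y := (Y : V)) q := by
    refine Eq.trans ?_ (Finsupp.smul_single c q (1 : k)).symm
    simp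
  rw [e]
  exact this

@[simp] lemma pathLift_map_arrow (F : V ⥤q D) {x y : V} (a : x ⟶ y) :
    (pathLift k F).map (PathCat.arrow k a) = F.map a := by
  refine (pathLiftHom_single k F _ _).trans ?_
  rw [one_smul]
  exact Paths.lift_toPath F a

lemma map_eq_zero_of_mem_idealSpan {C : Type u} [Category.{v} C] [Preadditive C]
    [Linear k C] (Φ : C ⥤ D) [Φ.Additive] [Φ.Linear k] {r : MorphSet C}
    (hr : ∀ X Y, ∀ f ∈ r X Y, Φ.map f = 0) {X Y : C} {f : X ⟶ Y} (hf : f ∈ idealSpan k r X Y) :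
    Φ.map f = 0 := by
  have : idealSpan k r X Y ≤ LinearMap.ker (Φ.mapLinearMap k) := by
    refine Submodule.span_le.2 ?_
    rintro _ ⟨A, B, p, f, q, hf, rfl⟩
    simp [hr _ _ f hf]
  exact this hf

lemma functor_map_eq_zero_iff {C : Type u} [Category.{v} C] [Preadditive C]
    [Linear k C] (r : MorphSet C) {X Y : C} (f : X ⟶ Y) :
    (Quotient.functor (idealRel k r)).map f = 0 ↔ f ∈ idealSpan k r X Y := by
  rw [← Functor.map_zero (Quotient.functor (idealRel k r)), Quotient.functor_map_eq_iff, idealRel,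
    sub_zero]

lemma functor_map_eq_of_sub_mem {C : Type u} [Category.{v} C] [Preadditive C]
    [Linear k C] {r : MorphSet C} {X Y : C} {f g : X ⟶ Y} (h : f - g ∈ r X Y) :
    (Quotient.functor (idealRel k r)).map f = (Quotient.functor (idealRel k r)).map g := by
  rw [Quotient.functor_map_eq_iff]
  exact Submodule.subset_span ⟨X, Y, 𝟙 X, f - g, 𝟙 Y, h, by simp⟩

lemma functor_map_eq_zero_of_mem {C : Type u} [Category.{v} C] [Preadditive C]
    [Linear k C] {r : MorphSet C} {X Y : C} {f : X ⟶ Y} (h : f ∈ r X Y) :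
    (Quotient.functor (idealRel k r)).map f = 0 :=
  (functor_map_eq_zero_iff r f).2 (Submodule.subset_span ⟨X, Y, 𝟙 X, f, 𝟙 Y, h, by simp⟩)

end PathCat

/-! ### Isomorphisms of categories -/

section Isomorphism

/-- A fully faithful functor that is bijective on objects is an isomorphism of categories. -/
lemma exists_inverse_of_bijective {C : Type u} [Category.{v} C] {D : Type w} [Category.{us} D]
    (Φ : C ⥤ D) [Φ.Full] [Φ.Faithful] (h : Function.Bijective Φ.obj) :
    ∃ Θ : D ⥤ C, Φ ⋙ Θ = 𝟭 _ ∧ Θ ⋙ Φ = 𝟭 _ := by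
  let e := Equiv.ofBijective _ h
  have he : ∀ d, Φ.obj (e.symm d) = d := e.apply_symm_apply
  have he' : ∀ c, e.symm (Φ.obj c) = c := e.symm_apply_apply
  let Θ : D ⥤ C :=
    { obj := e.symm
      map := fun {X Y} f => Φ.preimage (eqToHom (he X) ≫ f ≫ eqToHom (he Y).symm)
      map_id := fun X => Φ.map_injective (by simp)
      map_comp := fun f g => Φ.map_injective (by simp) }
  refine ⟨Θ, CategoryTheory.Functor.ext he' fun X Y f => Φ.map_injective ?_,
    CategoryTheory.Functor.ext he fun X Y f => ?_⟩
  · simp [Θ, eqToHom_map]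
  · simp [Θ]

end Isomorphism

/-! ### Functoriality of the algebra of a category -/

namespace CatAlg

variable {C : Type u} [Category.{v} C] [Preadditive C]
  {D : Type w} [Category.{us} D] [Preadditive D]

open Classical in
/-- The additive map between the algebras of two categories induced by a functor. -/
def mapAdd (Φ : C ⥤ D) [Φ.Additive] : CatAlg C →+ CatAlg D :=
  DirectSum.toAddMonoid fun p => (single (Φ.obj p.1) (Φ.obj p.2)).comp Φ.mapAddHom

@[simp] lemma mapAdd_single (Φ : C ⥤ D) [Φ.Additive] {X Y : C} (f : X ⟶ Y) :
    mapAdd Φ (single X Y f) = single _ _ (Φ.map f) := by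
  classical
  exact DirectSum.toAddMonoid_of
    (fun p : C × C => (single (Φ.obj p.1) (Φ.obj p.2)).comp Φ.mapAddHom) (X, Y) f

/-- Injectivity on objects is essential: a product of non-composable entries is `0`, and it must
remain so after applying `Φ`. -/
lemma mapAdd_mul (Φ : C ⥤ D) [Φ.Additive] (h : Function.Injective Φ.obj) (a b : CatAlg C) :
    mapAdd Φ (a * b) = mapAdd Φ a * mapAdd Φ b := by
  refine ind (p := fun a => mapAdd Φ (a * b) = mapAdd Φ a * mapAdd Φ b) (by simp)
    (fun X Y f => ?_) (fun a b ha hb => by simp only [add_mul, map_add, ha, hb]) a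
  refine ind (p := fun b => mapAdd Φ (single X Y f * b) = mapAdd Φ (single X Y f) * mapAdd Φ b)
    (by simp) (fun X' Y' g => ?_) (fun a b ha hb => by simp only [mul_add, map_add, ha, hb]) b
  by_cases e : Y' = X
  · subst e
    simp [single_mul_single_same]
  · rw [single_mul_single_ne e, mapAdd_single, mapAdd_single,
      single_mul_single_ne (fun h' => e (h h')), map_zero]

lemma mapAdd_surjective (Φ : C ⥤ D) [Φ.Additive] [Φ.Full] (h : Function.Surjective Φ.obj) :
    Function.Surjective (mapAdd Φ) := by
  intro a
  refine ind (p := fun a => ∃ b, mapAdd Φ b = a) ⟨0, map_zero _⟩ (fun X Y f => ?_) ?_ a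
  · obtain ⟨X, rfl⟩ := h X
    obtain ⟨Y, rfl⟩ := h Y
    exact ⟨single _ _ (Φ.preimage f), by simp⟩
  · rintro _ _ ⟨a, rfl⟩ ⟨b, rfl⟩
    exact ⟨a + b, map_add _ _ _⟩

/-- The entry of a matrix at the position `(Y, X)`. -/
def entry (X Y : C) : CatAlg C →+ (X ⟶ Y) :=
  DFinsupp.evalAddMonoidHom (X, Y)

lemma entry_single_same {X Y : C} (f : X ⟶ Y) : entry X Y (single X Y f) = f := by
  classical
  exact DirectSum.of_eq_same (β := fun p : C × C => (p.1 ⟶ p.2)) (X, Y) f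

lemma entry_single_ne {X Y X' Y' : C} (h : (X', Y') ≠ (X, Y)) (f : X' ⟶ Y') :
    entry X Y (single X' Y' f) = 0 := by
  classical
  exact DirectSum.of_eq_of_ne (β := fun p : C × C => (p.1 ⟶ p.2)) (X', Y') (X, Y) f h.symm

/-- By injectivity on objects no two positions are merged, so the kernel of `mapAdd Φ` can be
computed entry by entry. -/
lemma entry_mapAdd (Φ : C ⥤ D) [Φ.Additive] (h : Function.Injective Φ.obj) (X Y : C)
    (a : CatAlg C) : entry (Φ.obj X) (Φ.obj Y) (mapAdd Φ a) = Φ.map (entry X Y a) := by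
  refine ind (p := fun a => entry (Φ.obj X) (Φ.obj Y) (mapAdd Φ a) = Φ.map (entry X Y a))
    (by simp) (fun X' Y' f => ?_) (fun a b ha hb => by simp only [Functor.map_add, map_add, ha, hb])
    a
  by_cases e : (X', Y') = (X, Y)
  · obtain ⟨rfl, rfl⟩ := Prod.mk.inj e
    rw [mapAdd_single, entry_single_same, entry_single_same]
  · rw [mapAdd_single, entry_single_ne e, entry_single_ne, Functor.map_zero]
    intro h'
    obtain ⟨h₁, h₂⟩ := Prod.mk.inj h'
    exact e (Prod.ext (h h₁) (h h₂))

lemma mem_of_entry_mem (I : TwoSidedIdeal (CatAlg C)) (a : CatAlg C)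
    (h : ∀ X Y, single X Y (entry X Y a) ∈ I) : a ∈ I := by
  classical
  have e := DirectSum.sum_support_of (β := fun p : C × C => (p.1 ⟶ p.2)) a
  rw [← show _ = a from e]
  exact sum_mem fun p _ => h p.1 p.2

lemma single_smul (k : Type uk) [CommRing k] [Linear k C] {X Y : C} (c : k) (f : X ⟶ Y) :
    single X Y (c • f) = c • single X Y f := by
  classical
  exact (DirectSum.lof k (C × C) (fun p => (p.1 ⟶ p.2)) (X, Y)).map_smul c f

lemma mapAdd_smul (k : Type uk) [CommRing k] [Linear k C] [Linear k D] (Φ : C ⥤ D) [Φ.Additive]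
    [Φ.Linear k] (c : k) (a : CatAlg C) : mapAdd Φ (c • a) = c • mapAdd Φ a := by
  refine ind (p := fun a => mapAdd Φ (c • a) = c • mapAdd Φ a) (by simp) (fun X Y f => ?_)
    (fun a b ha hb => by simp only [smul_add, map_add, ha, hb]) a
  rw [← single_smul, mapAdd_single, mapAdd_single, Functor.map_smul, single_smul]

end CatAlg

/-! ### From kernel and fullness to presentations -/

section Presentation

variable {k : Type uk} [CommRing k] {V : Type u} [Quiver.{v} V]
  {D : Type w} [Category.{us} D] [Preadditive D] [Linear k D]

lemma single_mem_pathAlgIdeal {r : MorphSet (PathCat k V)} {X Y : PathCat k V} {f : X ⟶ Y}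
    (hf : f ∈ idealSpan k r X Y) : CatAlg.single X Y f ∈ pathAlgIdeal k r := by
  refine Submodule.span_induction (p := fun f _ => CatAlg.single X Y f ∈ pathAlgIdeal k r)
    ?_ ?_ ?_ ?_ hf
  · rintro _ ⟨A, B, p, f, q, hf, rfl⟩
    rw [← CatAlg.single_mul_single_same, ← CatAlg.single_mul_single_same]
    exact TwoSidedIdeal.mul_mem_right _ _ _ (TwoSidedIdeal.mul_mem_left _ _ _
      (TwoSidedIdeal.subset_span ⟨_, _, f, hf, rfl⟩))
  · rw [map_zero]
    exact TwoSidedIdeal.zero_mem _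
  · intro f g _ _ hf hg
    rw [map_add]
    exact TwoSidedIdeal.add_mem _ hf hg
  · intro c f _ hf
    -- An ideal of a non-unital ring need not be closed under scalars. Here the scalar is absorbed
    -- into a multiple of the idempotent at `Y`.
    have : c • f = f ≫ (c • 𝟙 Y) := by simp
    rw [this, ← CatAlg.single_mul_single_same]
    exact TwoSidedIdeal.mul_mem_left _ _ _ hf

variable {F : V ⥤q D} {r : MorphSet (PathCat k V)}

lemma isCategoryPresentation_of_kernel (hobj : Function.Bijective F.obj)
    (hfull : (pathLift k F).Full)
    (hker : ∀ (X Y : PathCat k V) (f : X ⟶ Y),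
      (pathLift k F).map f = 0 ↔ f ∈ idealSpan k r X Y) :
    IsCategoryPresentation k F r := by
  have H : ∀ (X Y : PathCat k V) (f g : X ⟶ Y), idealRel k r f g ↔
      (pathLift k F).map f = (pathLift k F).map g := fun X Y f g => by
    rw [idealRel, ← hker, Functor.map_sub, sub_eq_zero]
  let Φ : IdealQuotient k r ⥤ D :=
    CategoryTheory.Quotient.lift _ (pathLift k F) fun X Y f g h => (H X Y f g).1 h
  have hΦ : ∀ {X Y : PathCat k V} (f : X ⟶ Y),
      Φ.map ((Quotient.functor (idealRel k r)).map f) = (pathLift k F).map f := fun f => rfl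
  have : Φ.Full := ⟨fun {X Y} g => by
    obtain ⟨f, hf⟩ := (pathLift k F).map_surjective (X := X.as) (Y := Y.as) g
    exact ⟨(Quotient.functor (idealRel k r)).map f, hf⟩⟩
  have : Φ.Faithful := ⟨fun {X Y} f g h => by
    obtain ⟨f, rfl⟩ := (Quotient.functor (idealRel k r)).map_surjective (X := X.as) (Y := Y.as) f
    obtain ⟨g, rfl⟩ := (Quotient.functor (idealRel k r)).map_surjective (X := X.as) (Y := Y.as) g
    exact CategoryTheory.Quotient.sound _ ((H _ _ f g).2 h)⟩
  obtain ⟨Θ, h₁, h₂⟩ := exists_inverse_of_bijective Φ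
    (hobj.comp (Quotient.equiv (idealRel k r)).bijective)
  refine ⟨Φ, Θ, ⟨fun {X Y} f g => ?_⟩, ⟨fun {X Y} f c => ?_⟩,
    CategoryTheory.Quotient.lift_spec _ _ _, h₁, h₂⟩
  · obtain ⟨f, rfl⟩ := (Quotient.functor (idealRel k r)).map_surjective (X := X.as) (Y := Y.as) f
    obtain ⟨g, rfl⟩ := (Quotient.functor (idealRel k r)).map_surjective (X := X.as) (Y := Y.as) g
    exact (pathLift k F).map_add
  · obtain ⟨f, rfl⟩ := (Quotient.functor (idealRel k r)).map_surjective (X := X.as) (Y := Y.as) f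
    exact (pathLift k F).map_smul c f

lemma isAlgebraPresentation_of_kernel (hobj : Function.Bijective F.obj)
    (hfull : (pathLift k F).Full)
    (hker : ∀ (X Y : PathCat k V) (f : X ⟶ Y),
      (pathLift k F).map f = 0 ↔ f ∈ idealSpan k r X Y) :
    IsAlgebraPresentation k F r := by
  let P := CatAlg.mapAdd (pathLift k F)
  have hmul : ∀ a b, P (a * b) = P a * P b := CatAlg.mapAdd_mul (pathLift k F) hobj.1
  have hP : ∀ a, P a = 0 ↔ a ∈ pathAlgIdeal k r := by
    refine fun a => ⟨fun ha => CatAlg.mem_of_entry_mem _ _ fun X Y => ?_, fun ha => ?_⟩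
    -- Each entry of `a` lies in the kernel of the functor, hence in the categorical ideal.
    · refine single_mem_pathAlgIdeal ((hker X Y _).1 ?_)
      rw [← CatAlg.entry_mapAdd (pathLift k F) hobj.1,
        show CatAlg.mapAdd (pathLift k F) a = 0 from ha, map_zero]
    -- The kernel of `P` is a two-sided ideal containing the generators, so it contains the ideal
    -- they span.
    · let I : TwoSidedIdeal (CatAlg (PathCat k V)) := TwoSidedIdeal.mk' {a | P a = 0}
        (map_zero P)
        (fun {a b} ha hb => by rw [Set.mem_ofPred_eq] at *; rw [map_add, ha, hb, add_zero])
        (fun {a} ha => by rw [Set.mem_ofPred_eq] at *; rw [map_neg, ha, neg_zero])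
        (fun {a b} hb => by rw [Set.mem_ofPred_eq] at *; rw [hmul, hb, mul_zero])
        (fun {a b} ha => by rw [Set.mem_ofPred_eq] at *; rw [hmul, ha, zero_mul])
      have hI : ∀ a, a ∈ I ↔ P a = 0 := fun a => TwoSidedIdeal.mem_mk' _ _ _ _ _ _ _
      have hle : pathAlgIdeal k r ≤ I := by
        refine TwoSidedIdeal.span_le.2 ?_
        rintro _ ⟨X, Y, f, hf, rfl⟩
        refine (hI _).2 ?_
        have := (hker X Y f).2 (Submodule.subset_span ⟨X, Y, 𝟙 X, f, 𝟙 Y, hf, by simp⟩)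
        simp [P, this]
      exact (hI a).1 (hle ha)
  have hrel : ∀ a b, (pathAlgIdeal k r).ringCon a b ↔ P a = P b := fun a b => by
    rw [TwoSidedIdeal.rel_iff, ← hP, map_sub, sub_eq_zero]
  let f : (pathAlgIdeal k r).ringCon.Quotient → CatAlg D :=
    Quotient.lift P fun a b h => (hrel a b).1 h
  have hf : Function.Bijective f := by
    constructor
    · rintro ⟨a⟩ ⟨b⟩ h
      exact Quotient.sound ((hrel a b).2 h)
    · intro b
      obtain ⟨a, ha⟩ := CatAlg.mapAdd_surjective (pathLift k F) hobj.2 b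
      exact ⟨RingCon.toQuotient a, ha⟩
  refine ⟨{ Equiv.ofBijective f hf with
    map_mul' := ?_
    map_add' := ?_ }, fun c a => ?_, fun x => ?_, fun x y a => ?_⟩
  · rintro ⟨a⟩ ⟨b⟩
    exact hmul a b
  · rintro ⟨a⟩ ⟨b⟩
    exact map_add P a b
  · exact CatAlg.mapAdd_smul k (pathLift k F) c a
  · refine (CatAlg.mapAdd_single (pathLift k F) (𝟙 (PathCat.vertex k x))).trans ?_
    rw [CategoryTheory.Functor.map_id]
    rfl
  · refine (CatAlg.mapAdd_single (pathLift k F) (PathCat.arrow k a)).trans ?_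
    rw [pathLift_map_arrow]
    rfl

end Presentation

/-! ### Morphisms out of an object that may be zero -/

section ExtendZero

namespace AddZero

lemma eq_of_or_eq_zero {A : Type u} (Z : AddZero A) : (∃ X, Z = of X) ∨ Z = zero := by
  cases Z with
  | of X => exact Or.inl ⟨X, rfl⟩
  | zero => exact Or.inr rfl

variable {A : Type u} [Category.{v} A] [Preadditive A]

/-- A morphism of `A` as a morphism of the category with the zero object added. -/
def inclHom {X Y : A} (f : X ⟶ Y) : of X ⟶ of Y := (incl A).map f

lemma exists_inclHom_eq {X Y : A} (f : of X ⟶ of Y) : ∃ g : X ⟶ Y, inclHom g = f :=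
  ⟨f, rfl⟩

lemma exists_eq_eqToHom_comp_inclHom {Z : AddZero A} {X Y : A} (h : Z = of X) (f : Z ⟶ of Y) :
    ∃ g : X ⟶ Y, f = eqToHom h ≫ inclHom g := by
  subst h
  exact ⟨f, (Category.id_comp (obj := AddZero A) f).symm⟩

lemma inclHom_id (X : A) : inclHom (𝟙 X) = 𝟙 (of X) := rfl

lemma inclHom_comp {X Y Z : A} (f : X ⟶ Y) (g : Y ⟶ Z) :
    inclHom (f ≫ g) = inclHom f ≫ inclHom g := rfl

lemma inclHom_add {X Y : A} (f g : X ⟶ Y) : inclHom (f + g) = inclHom f + inclHom g := rfl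

lemma inclHom_zero (X Y : A) : inclHom (0 : X ⟶ Y) = 0 := rfl

lemma inclHom_smul {k : Type uk} [CommRing k] [Linear k A] {X Y : A} (c : k) (f : X ⟶ Y) :
    inclHom (c • f) = c • inclHom f := rfl

lemma comp_eq_zero {X Y Z : AddZero A} (h : Y = zero) (f : X ⟶ Y) (g : Y ⟶ Z) : f ≫ g = 0 := by
  subst h
  rw [Subsingleton.elim g 0, Limits.comp_zero]

lemma eq_zero_of_source {X Y : AddZero A} (h : X = zero) (f : X ⟶ Y) : f = 0 := by
  subst h
  exact Subsingleton.elim _ _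

end AddZero

variable (k : Type uk) [CommRing k] {A : Type u} [Category.{v} A] [Preadditive A] [Linear k A]
  {B : Type w} [Category.{us} B] [Preadditive B] [Linear k B]
  (O : A ⥤ B) [O.Additive] [O.Linear k]

/-- The map sending `f : Z ⟶ y` to `P Z ≫ O f` if `Z` is not the zero object, and to `0`
otherwise. -/
def extendZero {b : B} (P : ∀ z : A, b ⟶ O.obj z) :
    ∀ (Z : AddZero A) (y : A), (Z ⟶ AddZero.of y) →ₗ[k] (b ⟶ O.obj y)
  | .of z, y => (Linear.leftComp k _ (P z)).comp (O.mapLinearMap k (X := z) (Y := y))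
  | .zero, _ => 0

variable {k O} {b : B} (P : ∀ z : A, b ⟶ O.obj z)

lemma extendZero_of {z y : A} (f : z ⟶ y) :
    extendZero k O P (.of z) y (AddZero.inclHom f) = P z ≫ O.map f := rfl

lemma extendZero_comp {Z : AddZero A} {y y' : A} (f : Z ⟶ .of y) (g : y ⟶ y') :
    extendZero k O P Z y' (f ≫ AddZero.inclHom g) = extendZero k O P Z y f ≫ O.map g := by
  cases Z with
  | of z =>
    refine (congrArg (P z ≫ ·) (O.map_comp (X := z) (Y := y) f g)).trans ?_
    exact (Category.assoc _ _ _).symm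
  | zero => exact (Limits.zero_comp (C := B)).symm

lemma extendZero_eqToHom {Z : AddZero A} {y : A} (h : Z = .of y) :
    extendZero k O P Z y (eqToHom h) = P y := by
  subst h
  refine (extendZero_of P (𝟙 y)).trans ?_
  simp

lemma extendZero_eqToHom_comp {Z Z' : AddZero A} {y : A} (h : Z = Z') (f : Z' ⟶ .of y) :
    extendZero k O P Z y (eqToHom h ≫ f) = extendZero k O P Z' y f := by
  subst h
  simp

end ExtendZero

/-! ### Words, their action and their paths -/

section Words

variable {k : Type uk} [CommRing k] {V : Type u} [Quiver.{v} V]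
  {ρ : MorphSet (PathCat k V)} {S : Type us} (t : S → ZEnd k (IdealQuotient k ρ))

/-- The action of words. -/
abbrev wordAct : WithZero (FreeMonoid S) →*₀ ZEnd k (IdealQuotient k ρ) :=
  WithZero.lift' (FreeMonoid.lift t)

/-- The action of the word whose letters, from right to left, are those of the list. -/
abbrev listAct (l : List S) : ZEnd k (IdealQuotient k ρ) :=
  FreeMonoid.lift t (FreeMonoid.ofList l.reverse)

/-- The head of the list acts first, so it is the rightmost letter of the word; this is the reason
for the reversal. -/
lemma listAct_cons_obj (s : S) (l : List S) (X : AddZero (IdealQuotient k ρ)) :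
    (listAct t (s :: l)).functor.obj X = (listAct t l).functor.obj ((t s).functor.obj X) := by
  have : listAct t (s :: l) = listAct t l * t s := by
    simp [listAct, FreeMonoid.ofList_append]
  rw [this]
  rfl

lemma piList_nil (x : V) : piList t [] x x = 𝟙 _ := by
  simp [piList]

lemma piList_cons_of {s : S} {l : List S} {x y z : V}
    (h : sAct t s x = .of (presVertex ρ z)) :
    piList t (s :: l) x y = newArrow t s h ≫ piList t l z y := by
  rw [piList]
  split
  · rename_i Z hZ
    obtain rfl : Z = presVertex ρ z := by
      rw [h] at hZ
      injection hZ with hZ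
      exact hZ.symm
    rfl
  · rename_i hZ
    rw [h] at hZ
    cases hZ

lemma piList_cons_zero {s : S} {l : List S} {x y : V} (h : sAct t s x = .zero) :
    piList t (s :: l) x y = 0 := by
  rw [piList]
  split
  · rename_i Z hZ
    rw [h] at hZ
    cases hZ
  · rfl

/-- The path follows the action on vertices, so it can end only at the vertex that the word reaches
from `x`, if there is one. -/
lemma piList_eq_zero {l : List S} {x y : V}
    (h : (listAct t l).functor.obj (.of (presVertex ρ x)) ≠ .of (presVertex ρ y)) :
    piList t l x y = 0 := by
  induction l generalizing x with
  | nil =>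
    have : x ≠ y := fun e => h (by rw [e]; rfl)
    simp [piList, this]
  | cons s l ih =>
    rw [listAct_cons_obj] at h
    cases hZ : sAct t s x with
    | of Z =>
      rw [piList_cons_of t (z := toVertex ρ Z) hZ, ih, Limits.comp_zero]
      rwa [show (t s).functor.obj (.of (presVertex ρ x)) = _ from hZ] at h
    | zero => exact piList_cons_zero t hZ

/-- The hypothesis says that the first path exists and ends at `y`, which is where the concatenation
is cut. -/
lemma piList_append {l l' : List S} {x y z : V}
    (h : (listAct t l).functor.obj (.of (presVertex ρ x)) = .of (presVertex ρ y)) :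
    piList t (l ++ l') x z = piList t l x y ≫ piList t l' y z := by
  induction l generalizing x with
  | nil =>
    obtain rfl : x = y := by
      injection (show AddZero.of (presVertex ρ x) = .of (presVertex ρ y) from h) with h
      exact congrArg (toVertex ρ) h
    rw [piList_nil, Category.id_comp]
    rfl
  | cons s l ih =>
    rw [listAct_cons_obj] at h
    cases hZ : sAct t s x with
    | of Z =>
      rw [show (t s).functor.obj (.of (presVertex ρ x)) = _ from hZ] at h
      rw [List.cons_append, piList_cons_of t (z := toVertex ρ Z) hZ,
        piList_cons_of t (z := toVertex ρ Z) hZ, ih (x := toVertex ρ Z) h, Category.assoc]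
    | zero =>
      -- The zero object is fixed by every letter, so a path that dies cannot reach `y`.
      rw [show (t s).functor.obj (.of (presVertex ρ x)) = _ from hZ, (listAct t l).obj_zero] at h
      cases h

lemma piWord_coe (w : FreeMonoid S) (x y : V) :
    piWord t (w : WithZero (FreeMonoid S)) x y = piList t w.toList.reverse x y := rfl

lemma piWord_zero (x y : V) : piWord t 0 x y = 0 := rfl

lemma listAct_reverse (w : FreeMonoid S) : listAct t w.toList.reverse = wordAct t w := by
  simp [listAct, wordAct]

lemma piWord_eq_zero {a : WithZero (FreeMonoid S)} {x y : V}
    (h : (wordAct t a).functor.obj (.of (presVertex ρ x)) ≠ .of (presVertex ρ y)) :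
    piWord t a x y = 0 := by
  induction a with
  | zero => rfl
  | coe w =>
    rw [← listAct_reverse] at h
    exact piList_eq_zero t h

lemma piWord_mul {a b : WithZero (FreeMonoid S)} {x y z : V}
    (h : (wordAct t a).functor.obj (.of (presVertex ρ x)) = .of (presVertex ρ y)) :
    piWord t (b * a) x z = piWord t a x y ≫ piWord t b y z := by
  induction a with
  | zero => cases h
  | coe a =>
    induction b with
    | zero => rw [zero_mul, piWord_zero, piWord_zero, Limits.comp_zero]
    | coe b =>
      rw [← listAct_reverse] at h
      rw [← WithZero.coe_mul, piWord_coe, FreeMonoid.toList_mul, List.reverse_append,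
        piList_append t h]
      rfl

lemma piWord_one (x : V) : piWord t 1 x x = 𝟙 _ := piList_nil t x

lemma piWord_of {s : S} {x y : V} (h : sAct t s x = .of (presVertex ρ y)) :
    piWord t (FreeMonoid.of s : FreeMonoid S) x y = newArrow t s h := by
  rw [piWord_coe]
  refine (piList_cons_of t (l := []) h).trans ?_
  rw [piList_nil, Category.comp_id]

end Words

/-! ### The category presented by `Q'`: congruence of words and the skew relation -/

section Quotient

variable {k : Type uk} [CommRing k] {V : Type u} [Quiver.{v} V]
  {ρ : MorphSet (PathCat k V)} {S : Type us} (t : S → ZEnd k (IdealQuotient k ρ))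
  (R : Set (WithZero (FreeMonoid S) × WithZero (FreeMonoid S)))

/-- The quotient of the path category of `Q'` by the three kinds of relations. -/
abbrev SkewCat := IdealQuotient k fun X Y => {f | skewRel t R X Y f}

/-- The projection from the path category of `Q'`. -/
abbrev skewProj : PathCat k (SkewQuiver t) ⥤ SkewCat t R :=
  Quotient.functor (idealRel k fun X Y => {f | skewRel t R X Y f})

instance : (oldInclusion t).Additive := inferInstanceAs (pathLift k (oldPrefunctor t)).Additive

instance : (oldInclusion t).Linear k := inferInstanceAs ((pathLift k (oldPrefunctor t)).Linear k)

/-- The functor from `k[Q, ρ]` to the category presented by `Q'`. -/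
def oldFunctor : IdealQuotient k ρ ⥤ SkewCat t R :=
  CategoryTheory.Quotient.lift _ (oldInclusion t ⋙ skewProj t R) fun X Y f g h => by
    have := map_eq_zero_of_mem_idealSpan (oldInclusion t ⋙ skewProj t R) (r := ρ)
      (fun X Y μ hμ => functor_map_eq_zero_of_mem (skewRel.old μ hμ)) h
    rwa [CategoryTheory.Functor.map_sub, sub_eq_zero] at this

lemma oldFunctor_map {X Y : PathCat k V} (μ : X ⟶ Y) :
    (oldFunctor t R).map ((Quotient.functor (idealRel k ρ)).map μ) =
      (skewProj t R).map ((oldInclusion t).map μ) := rfl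

instance : (oldFunctor t R).Additive where
  map_add {X Y f g} := by
    obtain ⟨f, rfl⟩ := (Quotient.functor (idealRel k ρ)).map_surjective (X := X.as) (Y := Y.as) f
    obtain ⟨g, rfl⟩ := (Quotient.functor (idealRel k ρ)).map_surjective (X := X.as) (Y := Y.as) g
    exact (oldInclusion t ⋙ skewProj t R).map_add

instance : (oldFunctor t R).Linear k where
  map_smul {X Y} f c := by
    obtain ⟨f, rfl⟩ := (Quotient.functor (idealRel k ρ)).map_surjective (X := X.as) (Y := Y.as) f
    exact (oldInclusion t ⋙ skewProj t R).map_smul c f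

/-- The class of `π(a, x)`. -/
def wordMor (a : WithZero (FreeMonoid S)) (X Y : IdealQuotient k ρ) :
    (oldFunctor t R).obj X ⟶ (oldFunctor t R).obj Y :=
  (skewProj t R).map (piWord t a (toVertex ρ X) (toVertex ρ Y))

variable {R} in
lemma wordMor_eq_zero {a : WithZero (FreeMonoid S)} {X Y : IdealQuotient k ρ}
    (h : (wordAct t a).functor.obj (.of X) ≠ .of Y) : wordMor t R a X Y = 0 :=
  (congrArg (skewProj t R).map (piWord_eq_zero t h)).trans ((skewProj t R).map_zero _ _)

variable {R} in
lemma wordMor_mul {a b : WithZero (FreeMonoid S)} {X Y Z : IdealQuotient k ρ}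
    (h : (wordAct t a).functor.obj (.of X) = .of Y) :
    wordMor t R (b * a) X Z = wordMor t R a X Y ≫ wordMor t R b Y Z :=
  (congrArg (skewProj t R).map (piWord_mul t (y := toVertex ρ Y) h)).trans
    ((skewProj t R).map_comp _ _)

lemma wordMor_one (X : IdealQuotient k ρ) : wordMor t R 1 X X = 𝟙 _ :=
  (congrArg (skewProj t R).map (piWord_one t (toVertex ρ X))).trans ((skewProj t R).map_id _)

lemma wordMor_of {s : S} {x y : V} (h : sAct t s x = .of (presVertex ρ y)) :
    wordMor t R (FreeMonoid.of s : FreeMonoid S) (presVertex ρ x) (presVertex ρ y) =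
      (skewProj t R).map (newArrow t s h) :=
  congrArg (skewProj t R).map (piWord_of t h)

variable {R} in
lemma wordMor_eq_of_mem {a b : WithZero (FreeMonoid S)} (h : (a, b) ∈ R)
    (X Y : IdealQuotient k ρ) : wordMor t R a X Y = wordMor t R b X Y :=
  functor_map_eq_of_sub_mem (skewRel.monoid h _ _)

/-- Words acting in the same way and giving the same morphisms in the category presented by `Q'`
are congruent. -/
def wordCon : Con (WithZero (FreeMonoid S)) where
  r a b := wordAct t a = wordAct t b ∧ ∀ X Y, wordMor t R a X Y = wordMor t R b X Y
  iseqv :=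
    { refl := fun _ => ⟨rfl, fun _ _ => rfl⟩
      symm := fun h => ⟨h.1.symm, fun X Y => (h.2 X Y).symm⟩
      trans := fun h h' => ⟨h.1.trans h'.1, fun X Y => (h.2 X Y).trans (h'.2 X Y)⟩ }
  mul' {a b c d} h h' := by
    refine ⟨by rw [map_mul, map_mul, h.1, h'.1], fun X Z => ?_⟩
    -- Both products are cut at the same object because related words act alike; this is why the
    -- relation also records the action. If that object is zero, both paths are `0`.
    cases hY : (wordAct t c).functor.obj (.of X) with
    | of Y =>
      rw [wordMor_mul t hY, wordMor_mul t (a := d) (Y := Y) (by rw [← h'.1, hY]), h.2, h'.2]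
    | zero =>
      rw [wordMor_eq_zero, wordMor_eq_zero]
      · rw [map_mul, ← h'.1]
        intro e
        replace e : (wordAct t b).functor.obj ((wordAct t c).functor.obj (.of X)) = _ := e
        rw [hY, ZEnd.obj_zero] at e
        cases e
      · rw [map_mul]
        intro e
        replace e : (wordAct t a).functor.obj ((wordAct t c).functor.obj (.of X)) = _ := e
        rw [hY, ZEnd.obj_zero] at e
        cases e

/-- The relation `(s, y) f = s(f) (s, x)` for a morphism `f : x ⟶ y` of `k[Q, ρ]`. -/
def IsSkew (s : S) {X Y : IdealQuotient k ρ} (f : X ⟶ Y) : Prop :=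
  ∀ (Y' : IdealQuotient k ρ) (hY : (t s).functor.obj (.of Y) = .of Y'),
    (oldFunctor t R).map f ≫ wordMor t R (FreeMonoid.of s : FreeMonoid S) Y Y' =
      extendZero k (oldFunctor t R) (wordMor t R (FreeMonoid.of s : FreeMonoid S) X) _ Y'
        ((t s).functor.map (AddZero.inclHom f) ≫ eqToHom hY)

variable {t R} {s : S}

/-- This is a defining relation: `skewRel.skew` for a chosen lift `μ` of `s(α)` if `s x` is an
object of `k[Q, ρ]`, and `skewRel.skewZero` if `s x = 0`. -/
lemma isSkew_presArrow {x y : V} (α : x ⟶ y) : IsSkew t R s (presArrow ρ α) := by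
  intro Y' hY
  have e := wordMor_of t R (s := s) (x := y) (y := toVertex ρ Y') hY
  refine (congrArg ((oldFunctor t R).map (presArrow ρ α) ≫ ·) e).trans ?_
  have e' : (oldFunctor t R).map (presArrow ρ α) = (skewProj t R).map (oldArrow t α) :=
    (oldFunctor_map t R _).trans (congrArg (skewProj t R).map (pathLift_map_arrow _ _))
  refine (congrArg (· ≫ (skewProj t R).map (newArrow t s hY)) e').trans ?_
  refine ((skewProj t R).map_comp _ _).symm.trans ?_
  obtain ⟨X', hX⟩ | hX := AddZero.eq_of_or_eq_zero ((t s).functor.obj (.of (presVertex ρ x)))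
  · obtain ⟨m, hμ'⟩ := AddZero.exists_inclHom_eq (eqToHom hX.symm ≫
      (t s).functor.map (AddZero.inclHom (presArrow ρ α)) ≫ eqToHom hY)
    obtain ⟨μ, hμ⟩ :=
      (Quotient.functor (idealRel k ρ)).map_surjective (X := X'.as) (Y := Y'.as) m
    have hm : (t s).functor.map (AddZero.inclHom (presArrow ρ α)) = eqToHom hX ≫
        AddZero.inclHom m ≫ eqToHom hY.symm := by
      rw [hμ']; simp
    refine (functor_map_eq_of_sub_mem (k := k) (r := fun X Y => {f | skewRel t R X Y f})
      (skewRel.skew (R := R) α s (x' := X'.as) (y' := Y'.as) hX hY μ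
        (by subst hμ; exact hm))).trans ?_
    have h₂ : (t s).functor.map (AddZero.inclHom (presArrow ρ α)) ≫ eqToHom hY =
        eqToHom hX ≫ AddZero.inclHom m := by
      rw [hμ']; simp
    rw [h₂, extendZero_comp, ← hμ]
    rw [extendZero_eqToHom]
    refine ((skewProj t R).map_comp _ _).trans ?_
    exact congrArg (· ≫ _) (wordMor_of t R (x := x) (y := toVertex ρ X') hX).symm
  · refine (functor_map_eq_zero_of_mem (skewRel.skewZero α s hX hY)).trans ?_
    have h₂ : (t s).functor.map (AddZero.inclHom (presArrow ρ α)) ≫ eqToHom hY = 0 :=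
      AddZero.eq_zero_of_source hX _
    refine Eq.trans ?_ (congrArg _ h₂).symm
    rw [map_zero]
    rfl

/-- The new arrow is moved past `g` and then past `f`, and functoriality of `s` reassembles the
result. If `s` sends the middle object to zero, the image of the composite factors through zero and
both sides vanish. -/
lemma IsSkew.comp {X Y Z : IdealQuotient k ρ} {f : X ⟶ Y} {g : Y ⟶ Z} (hf : IsSkew t R s f)
    (hg : IsSkew t R s g) : IsSkew t R s (f ≫ g) := by
  intro Z' hZ
  rw [CategoryTheory.Functor.map_comp, Category.assoc, hg Z' hZ]
  obtain ⟨Y', hY⟩ | hY := AddZero.eq_of_or_eq_zero ((t s).functor.obj (.of Y))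
  · obtain ⟨m, hm⟩ : ∃ m : Y' ⟶ Z', (t s).functor.map (AddZero.inclHom g) ≫ eqToHom hZ =
        eqToHom hY ≫ AddZero.inclHom m := by
      obtain ⟨m, hm⟩ := AddZero.exists_inclHom_eq (eqToHom hY.symm ≫
        (t s).functor.map (AddZero.inclHom g) ≫ eqToHom hZ)
      exact ⟨m, by rw [hm]; simp⟩
    have e : (t s).functor.map (AddZero.inclHom (f ≫ g)) ≫ eqToHom hZ =
        ((t s).functor.map (AddZero.inclHom f) ≫ eqToHom hY) ≫ AddZero.inclHom m := by
      rw [AddZero.inclHom_comp, CategoryTheory.Functor.map_comp, Category.assoc, Category.assoc,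
        ← hm]
    rw [e, extendZero_comp, ← hf Y' hY, hm, extendZero_comp, extendZero_eqToHom, Category.assoc]
  · rw [AddZero.eq_zero_of_source hY ((t s).functor.map (AddZero.inclHom g) ≫ eqToHom hZ),
      AddZero.inclHom_comp, CategoryTheory.Functor.map_comp, AddZero.comp_eq_zero hY,
      Limits.zero_comp, map_zero, map_zero, Limits.comp_zero]

/-- Both sides are linear in `f`, so the relation spreads from arrows through paths to all
morphisms. -/
lemma isSkew (s : S) {X Y : IdealQuotient k ρ} (f : X ⟶ Y) : IsSkew t R s f := by
  obtain ⟨μ, rfl⟩ := (Quotient.functor (idealRel k ρ)).map_surjective (X := X.as) (Y := Y.as) f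
  refine PathCat.hom_ind
    (p := fun X Y μ => IsSkew t R s ((Quotient.functor (idealRel k ρ)).map μ))
    (fun X Y Y' hY => ?_) (fun X Y f g hf hg Y' hY => ?_) (fun X Y c f hf Y' hY => ?_)
    (fun x Y' hY => ?_) (fun x y z f a hf => ?_) μ
  · have : AddZero.inclHom
        ((Quotient.functor (idealRel k ρ)).map (0 : X ⟶ Y)) = 0 :=
      (Quotient.functor (idealRel k ρ)).map_zero X Y
    rw [this]
    simp
  · have : AddZero.inclHom ((Quotient.functor (idealRel k ρ)).map (f + g)) =
        AddZero.inclHom ((Quotient.functor (idealRel k ρ)).map f) +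
        AddZero.inclHom ((Quotient.functor (idealRel k ρ)).map g) :=
      (Quotient.functor (idealRel k ρ)).map_add
    rw [this, CategoryTheory.Functor.map_add, CategoryTheory.Functor.map_add,
      CategoryTheory.Functor.map_add, Preadditive.add_comp, Preadditive.add_comp, map_add,
      hf Y' hY, hg Y' hY]
  · have : AddZero.inclHom ((Quotient.functor (idealRel k ρ)).map (c • f)) =
        c • AddZero.inclHom ((Quotient.functor (idealRel k ρ)).map f) :=
      (Quotient.functor (idealRel k ρ)).map_smul c f
    rw [this, CategoryTheory.Functor.map_smul, CategoryTheory.Functor.map_smul,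
      CategoryTheory.Functor.map_smul, Linear.smul_comp, Linear.smul_comp, map_smul, hf Y' hY]
  · rw [CategoryTheory.Functor.map_id, CategoryTheory.Functor.map_id, AddZero.inclHom_id,
      CategoryTheory.Functor.map_id, Category.id_comp]
    refine Eq.trans ?_ (congrArg _ (Category.id_comp _).symm)
    exact (extendZero_eqToHom _ hY).symm
  · rw [CategoryTheory.Functor.map_comp]
    exact hf.comp (isSkew_presArrow a)

end Quotient

/-! ### Transport along equalities of objects -/

section EqToHom

variable {C : Type u} [Category.{v} C]

lemma comp_eqToHom_of_eq {X X' Y Y' : C} {f : X ⟶ Y} {m : X' ⟶ Y'} {hx : X = X'} {hy : Y = Y'}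
    (h : f = eqToHom hx ≫ m ≫ eqToHom hy.symm) : f ≫ eqToHom hy = eqToHom hx ≫ m := by
  simp [h]

lemma eqToHom_comp_map_eqToHom_comp (F : C ⥤ C) {W X Y Z : C} (h₁ : W = F.obj X) (h₂ : X = Y)
    (h₃ : F.obj Y = Z) :
    eqToHom h₁ ≫ F.map (eqToHom h₂) ≫ eqToHom h₃ =
      eqToHom (h₁.trans ((congrArg F.obj h₂).trans h₃)) := by
  simp [eqToHom_map]

end EqToHom

/-! ### The functor to the orbit category and its values on relations -/

section Orbit

variable {k : Type uk} [CommRing k] {V : Type u} [Quiver.{v} V]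
  {ρ : MorphSet (PathCat k V)} {S : Type us} {G : Type ug} [Monoid G]
  (φ : G →* ZEnd k (IdealQuotient k ρ)) (gen : S → G)

namespace Orbit

variable {φ}

/-- The morphism of the orbit category given by an element of the component of `g`. -/
def homSingle {X Y : Orbit φ} (g : G) (f : act φ g X.as ⟶ .of Y.as) : X ⟶ Y := single g f

lemma homSingle_comp {X Y Z : Orbit φ} (g h : G) (f : act φ g X.as ⟶ .of Y.as)
    (f' : act φ h Y.as ⟶ .of Z.as) :
    homSingle g f ≫ homSingle h f' = (homSingle (h * g)
      (eqToHom (act_mul φ h g X.as) ≫ (φ h).functor.map f ≫ f') : X ⟶ Z) :=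
  comp_single g h f f'

lemma homSingle_congr {X Y : Orbit φ} {g h : G} (e : g = h) (f : act φ g X.as ⟶ .of Y.as)
    (f' : act φ h X.as ⟶ .of Y.as) (H : f = eqToHom (by rw [e]) ≫ f') :
    (homSingle g f : X ⟶ Y) = homSingle h f' :=
  single_congr e f f' H

lemma homSingle_add {X Y : Orbit φ} (g : G) (f f' : act φ g X.as ⟶ .of Y.as) :
    (homSingle g (f + f') : X ⟶ Y) = homSingle g f + homSingle g f' :=
  map_add (single g) f f'

lemma homSingle_zero {X Y : Orbit φ} (g : G) :
    (homSingle g (0 : act φ g X.as ⟶ .of Y.as) : X ⟶ Y) = 0 :=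
  map_zero (single g)

lemma homSingle_smul {X Y : Orbit φ} (c : k) (g : G) (f : act φ g X.as ⟶ .of Y.as) :
    (homSingle g (c • f) : X ⟶ Y) = c • homSingle g f :=
  single_smul c g f

lemma homSingle_ind {X Y : Orbit φ} {p : (X ⟶ Y) → Prop} (zero : p 0)
    (single : ∀ g f, p (homSingle g f)) (add : ∀ a b, p a → p b → p (a + b)) (a : X ⟶ Y) : p a :=
  hom_ind zero single add a

lemma id_eq (X : Orbit φ) : 𝟙 X = homSingle 1 (eqToHom (act_one φ X.as)) := rfl

/-- A morphism of the original category as a morphism of the orbit category. -/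
def ofHom {X Y : IdealQuotient k ρ} (f : X ⟶ Y) : (⟨X⟩ : Orbit φ) ⟶ ⟨Y⟩ :=
  homSingle 1 (eqToHom (act_one φ X) ≫ AddZero.inclHom f)

/-- There is no twist on this side, because `1` acts as the identity functor. -/
lemma homSingle_comp_ofHom {X : Orbit φ} {Y Z : IdealQuotient k ρ} (g : G)
    (f : act φ g X.as ⟶ .of Y) (m : Y ⟶ Z) :
    (homSingle g f : X ⟶ ⟨Y⟩) ≫ (ofHom m : (⟨Y⟩ : Orbit φ) ⟶ ⟨Z⟩) =
      homSingle g (f ≫ AddZero.inclHom m) := by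
  rw [ofHom, homSingle_comp]
  refine homSingle_congr (one_mul g) _ _ ?_
  have h : (φ 1).functor = 𝟭 _ := by rw [map_one]; rfl
  simp [Functor.congr_hom h f]

/-- Here `m` is twisted by `g`; this is the source of the skew relation. -/
lemma ofHom_comp_homSingle {X Y : IdealQuotient k ρ} {Z : Orbit φ} (g : G)
    (m : X ⟶ Y) (f : act φ g Y ⟶ .of Z.as) :
    (ofHom m : (⟨X⟩ : Orbit φ) ⟶ ⟨Y⟩) ≫ (homSingle g f : ⟨Y⟩ ⟶ Z) =
      homSingle g ((φ g).functor.map (AddZero.inclHom m) ≫ f) := by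
  rw [ofHom, homSingle_comp]
  refine homSingle_congr (mul_one g) _ _ ?_
  simp [eqToHom_map]

lemma ofHom_comp {X Y Z : IdealQuotient k ρ} (f : X ⟶ Y) (g : Y ⟶ Z) :
    (ofHom f : (⟨X⟩ : Orbit φ) ⟶ ⟨Y⟩) ≫ ofHom g = ofHom (f ≫ g) := by
  refine (homSingle_comp_ofHom _ _ _).trans ?_
  rw [ofHom, AddZero.inclHom_comp, Category.assoc]

end Orbit

/-- The letters act through their images in `G`. -/
abbrev genAct (s : S) : ZEnd k (IdealQuotient k ρ) := φ (gen s)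

/-- The functor given by the interpretation of `Q'` in the orbit category. -/
abbrev skewFunctor : PathCat k (SkewQuiver (genAct φ gen)) ⥤ Orbit φ :=
  pathLift k (skewInterp φ gen)

lemma skewFunctor_oldArrow {x y : V} (α : x ⟶ y) :
    (skewFunctor φ gen).map (oldArrow (genAct φ gen) α) = Orbit.ofHom (presArrow ρ α) :=
  pathLift_map_arrow _ _

lemma skewFunctor_newArrow {s : S} {x y : V}
    (h : sAct (genAct φ gen) s x = .of (presVertex ρ y)) :
    (skewFunctor φ gen).map (newArrow (genAct φ gen) s h) =
      (Orbit.homSingle (gen s) (eqToHom h) :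
        (⟨presVertex ρ x⟩ : Orbit φ) ⟶ ⟨presVertex ρ y⟩) :=
  pathLift_map_arrow _ _

/-- Both ways from `k[Q]` to the orbit category are linear and functorial and agree on arrows. This
gives relation (1), and it also evaluates the lifts used in relation (2) and for fullness. -/
lemma skewFunctor_oldInclusion {X Y : PathCat k V} (μ : X ⟶ Y) :
    (skewFunctor φ gen).map ((oldInclusion (genAct φ gen)).map μ) =
      Orbit.ofHom ((Quotient.functor (idealRel k ρ)).map μ) := by
  refine PathCat.hom_ind (p := fun X Y μ =>
    (skewFunctor φ gen).map ((oldInclusion (genAct φ gen)).map μ) =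
      Orbit.ofHom ((Quotient.functor (idealRel k ρ)).map μ))
    (fun X Y => ?_) (fun X Y f g hf hg => ?_) (fun X Y c f hf => ?_)
    (fun x => ?_) (fun x y z f a hf => ?_) μ
  · rw [CategoryTheory.Functor.map_zero, CategoryTheory.Functor.map_zero,
      CategoryTheory.Functor.map_zero, Orbit.ofHom, AddZero.inclHom_zero, Limits.comp_zero]
    exact (Orbit.homSingle_zero _).symm
  · rw [CategoryTheory.Functor.map_add, CategoryTheory.Functor.map_add,
      CategoryTheory.Functor.map_add, Orbit.ofHom, AddZero.inclHom_add, Preadditive.comp_add, hf,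
      hg]
    exact (Orbit.homSingle_add _ _ _).symm
  · rw [CategoryTheory.Functor.map_smul, CategoryTheory.Functor.map_smul,
      CategoryTheory.Functor.map_smul, Orbit.ofHom, AddZero.inclHom_smul, Linear.comp_smul, hf]
    exact (Orbit.homSingle_smul _ _ _).symm
  · rw [CategoryTheory.Functor.map_id, CategoryTheory.Functor.map_id,
      CategoryTheory.Functor.map_id, Orbit.ofHom, AddZero.inclHom_id, Category.comp_id]
    rfl
  · rw [CategoryTheory.Functor.map_comp, CategoryTheory.Functor.map_comp,
      CategoryTheory.Functor.map_comp, hf]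
    refine Eq.trans ?_ (Orbit.ofHom_comp _ _)
    exact congrArg (_ ≫ ·) ((congrArg (skewFunctor φ gen).map (pathLift_map_arrow _ _)).trans
      (skewFunctor_oldArrow φ gen a))

lemma listAct_genAct (l : List S) : listAct (genAct φ gen) l =
    φ (FreeMonoid.lift gen (FreeMonoid.ofList l.reverse)) := by
  have : FreeMonoid.lift (genAct φ gen) = φ.comp (FreeMonoid.lift gen) :=
    FreeMonoid.hom_eq fun s => by simp
  rw [listAct, this]
  rfl

/-- Each new arrow is an identity in its component. Functors preserve identities, so the twisted
composite is again an identity, now in the component of the product. -/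
lemma skewFunctor_piList {l : List S} {g : G}
    (hg : FreeMonoid.lift gen (FreeMonoid.ofList l.reverse) = g) {x y : V}
    (h : Orbit.act φ g (presVertex ρ x) = .of (presVertex ρ y)) :
    (skewFunctor φ gen).map (piList (genAct φ gen) l x y) =
      (Orbit.homSingle g (eqToHom h) : (⟨presVertex ρ x⟩ : Orbit φ) ⟶ ⟨presVertex ρ y⟩) := by
  induction l generalizing x g with
  | nil =>
    obtain rfl : 1 = g := by simpa using hg
    obtain rfl : x = y := by
      rw [Orbit.act_one] at h
      injection h with h
      exact congrArg (toVertex ρ) h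
    rw [piList_nil, CategoryTheory.Functor.map_id]
    rfl
  | cons s l ih =>
    obtain ⟨Z, hz⟩ | hz := AddZero.eq_of_or_eq_zero (sAct (genAct φ gen) s x)
    · obtain ⟨z, rfl⟩ : ∃ z, Z = presVertex ρ z := ⟨toVertex ρ Z, rfl⟩
      have hg' : FreeMonoid.lift gen (FreeMonoid.ofList l.reverse) * gen s = g := by
        rw [← hg]
        simp [FreeMonoid.ofList_append]
      subst hg'
      have h' : Orbit.act φ (FreeMonoid.lift gen (FreeMonoid.ofList l.reverse)) (presVertex ρ z) =
          .of (presVertex ρ y) := by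
        rw [← h, Orbit.act_mul, Orbit.act]
        exact congrArg _ hz.symm
      rw [piList_cons_of _ hz, CategoryTheory.Functor.map_comp,
        skewFunctor_newArrow, ih rfl h']
      refine (Orbit.homSingle_comp _ _ _ _).trans ?_
      exact congrArg (Orbit.homSingle _) (eqToHom_comp_map_eqToHom_comp _ _ _ _)
    · exfalso
      have h' := listAct_cons_obj (genAct φ gen) s l (.of (presVertex ρ x))
      rw [listAct_genAct, hg, show (genAct φ gen s).functor.obj (.of (presVertex ρ x)) = _ from hz,
        ZEnd.obj_zero] at h'
      cases h.symm.trans h'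

lemma wordAct_coe (w : FreeMonoid S) :
    wordAct (genAct φ gen) (w : WithZero (FreeMonoid S)) = φ (FreeMonoid.lift gen w) := by
  rw [← listAct_reverse, listAct_genAct]
  simp

lemma skewFunctor_piWord {w : FreeMonoid S} {x y : V}
    (h : Orbit.act φ (FreeMonoid.lift gen w) (presVertex ρ x) = .of (presVertex ρ y)) :
    (skewFunctor φ gen).map (piWord (genAct φ gen) (w : WithZero (FreeMonoid S)) x y) =
      (Orbit.homSingle (FreeMonoid.lift gen w) (eqToHom h) :
        (⟨presVertex ρ x⟩ : Orbit φ) ⟶ ⟨presVertex ρ y⟩) :=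
  skewFunctor_piList φ gen (by simp) h

/-- If the common value takes `x` to `y`, both images are the same identity; otherwise both paths
are already `0` in `k[Q']`. -/
lemma skewFunctor_piWord_congr {w w' : FreeMonoid S}
    (e : FreeMonoid.lift gen w = FreeMonoid.lift gen w') (x y : V) :
    (skewFunctor φ gen).map (piWord (genAct φ gen) (w : WithZero (FreeMonoid S)) x y) =
      (skewFunctor φ gen).map (piWord (genAct φ gen) (w' : WithZero (FreeMonoid S)) x y) := by
  by_cases h : Orbit.act φ (FreeMonoid.lift gen w) (presVertex ρ x) = .of (presVertex ρ y)
  · rw [skewFunctor_piWord φ gen h, skewFunctor_piWord φ gen (by rw [← e, h])]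
    exact Orbit.homSingle_congr e _ _ (by simp)
  · rw [piWord_eq_zero, piWord_eq_zero]
    · rwa [wordAct_coe, ← e]
    · rwa [wordAct_coe]

variable (R : Set (WithZero (FreeMonoid S) × WithZero (FreeMonoid S)))

/-- Relations (1) and (2) hold for any action. Only (3) depends on how `G` is presented, so it
enters as the hypothesis `hR`. -/
lemma skewFunctor_map_eq_zero
    (hR : ∀ a b, (a, b) ∈ R → ∀ x y : V,
      (skewFunctor φ gen).map (piWord (genAct φ gen) a x y) =
        (skewFunctor φ gen).map (piWord (genAct φ gen) b x y))
    {X Y : PathCat k (SkewQuiver (genAct φ gen))} {f : X ⟶ Y}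
    (hf : skewRel (genAct φ gen) R X Y f) : (skewFunctor φ gen).map f = 0 := by
  cases hf with
  | old μ hμ =>
    rw [skewFunctor_oldInclusion, functor_map_eq_zero_of_mem hμ, Orbit.ofHom,
      AddZero.inclHom_zero, Limits.comp_zero]
    exact Orbit.homSingle_zero _
  | skew α s hx hy μ hμ =>
    rw [CategoryTheory.Functor.map_sub, sub_eq_zero, CategoryTheory.Functor.map_comp,
      CategoryTheory.Functor.map_comp, skewFunctor_oldArrow, skewFunctor_newArrow,
      skewFunctor_newArrow]
    refine (Orbit.ofHom_comp_homSingle _ _ _).trans (Eq.trans ?_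
      (congrArg (_ ≫ ·) (skewFunctor_oldInclusion φ gen μ)).symm)
    refine Eq.trans ?_ (Orbit.homSingle_comp_ofHom _ _ _).symm
    exact congrArg (Orbit.homSingle (gen s)) (comp_eqToHom_of_eq hμ)
  | skewZero α s hx hy =>
    rw [CategoryTheory.Functor.map_comp, skewFunctor_oldArrow, skewFunctor_newArrow]
    have e : (φ (gen s)).functor.map (AddZero.inclHom (presArrow ρ α)) ≫ eqToHom hy = 0 :=
      AddZero.eq_zero_of_source hx _
    exact (Orbit.ofHom_comp_homSingle _ _ _).trans
      ((congrArg (Orbit.homSingle (gen s)) e).trans (Orbit.homSingle_zero _))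
  | monoid hgh x y =>
    rw [CategoryTheory.Functor.map_sub, sub_eq_zero]
    exact hR _ _ hgh x y

end Orbit

/-! ### The inverse on morphisms, and fullness -/

section Inverse

variable {k : Type uk} [CommRing k] {V : Type u} [Quiver.{v} V]
  {ρ : MorphSet (PathCat k V)} {S : Type us} {G : Type ug} [Monoid G]
  (φ : G →* ZEnd k (IdealQuotient k ρ)) (gen : S → G)
  (R : Set (WithZero (FreeMonoid S) × WithZero (FreeMonoid S)))
  (rep : G → WithZero (FreeMonoid S))

open Classical in
/-- The map from the orbit category to the category presented by `Q'` which sends `f : g x ⟶ y` to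
`f π(w, x)`, where `w` is the chosen word representing `g`. -/
def orbitToSkew (X Y : Orbit φ) :
    (X ⟶ Y) →ₗ[k] ((oldFunctor (genAct φ gen) R).obj X.as ⟶
      (oldFunctor (genAct φ gen) R).obj Y.as) :=
  DirectSum.toModule k G _ fun g =>
    extendZero k (oldFunctor (genAct φ gen) R) (wordMor (genAct φ gen) R (rep g) X.as)
      (Orbit.act φ g X.as) Y.as

lemma orbitToSkew_homSingle {X Y : Orbit φ} (g : G) (f : Orbit.act φ g X.as ⟶ .of Y.as) :
    orbitToSkew φ gen R rep X Y (Orbit.homSingle g f) =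
      extendZero k (oldFunctor (genAct φ gen) R) (wordMor (genAct φ gen) R (rep g) X.as)
        _ _ f := by
  classical
  exact DirectSum.toModule_lof k (M := fun g => (Orbit.act φ g X.as ⟶ AddZero.of Y.as)) g f

lemma orbitToSkew_comp_ofHom {X : Orbit φ} {Y Z : IdealQuotient k ρ} (u : X ⟶ ⟨Y⟩) (m : Y ⟶ Z) :
    orbitToSkew φ gen R rep X ⟨Z⟩ (u ≫ Orbit.ofHom m) =
      orbitToSkew φ gen R rep X ⟨Y⟩ u ≫ (oldFunctor (genAct φ gen) R).map m := by
  refine Orbit.homSingle_ind (p := fun u => orbitToSkew φ gen R rep X ⟨Z⟩ (u ≫ Orbit.ofHom m) =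
      orbitToSkew φ gen R rep X ⟨Y⟩ u ≫ (oldFunctor (genAct φ gen) R).map m) (by simp)
    (fun g f => ?_) (fun a b ha hb => by
      rw [Preadditive.add_comp, map_add, map_add, Preadditive.add_comp, ha, hb]) u
  rw [Orbit.homSingle_comp_ofHom, orbitToSkew_homSingle, orbitToSkew_homSingle]
  exact extendZero_comp _ _ _

variable {R rep}

/-- Take `u` to be `f` in the component of `g`. By `isSkew`, the new arrow after `f` equals the new
arrow out of `g x` followed by `s(f)`. The path is then that of the word `s * rep g`, which `hmul`
exchanges for the representative of `gen s * g`. -/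
lemma orbitToSkew_comp_gen
    (hact : ∀ g, wordAct (genAct φ gen) (rep g) = φ g)
    (hmul : ∀ s g X Y, wordMor (genAct φ gen) R (rep (gen s * g)) X Y =
      wordMor (genAct φ gen) R ((FreeMonoid.of s : FreeMonoid S) * rep g) X Y)
    {X : Orbit φ} {Y Z : IdealQuotient k ρ} (u : X ⟶ ⟨Y⟩) (s : S)
    (h : Orbit.act φ (gen s) Y = .of Z) :
    orbitToSkew φ gen R rep X ⟨Z⟩ (u ≫ Orbit.homSingle (gen s) (eqToHom h)) =
      orbitToSkew φ gen R rep X ⟨Y⟩ u ≫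
        wordMor (genAct φ gen) R (FreeMonoid.of s : FreeMonoid S) Y Z := by
  refine Orbit.homSingle_ind (p := fun u =>
      orbitToSkew φ gen R rep X ⟨Z⟩ (u ≫ Orbit.homSingle (gen s) (eqToHom h)) =
      orbitToSkew φ gen R rep X ⟨Y⟩ u ≫
        wordMor (genAct φ gen) R (FreeMonoid.of s : FreeMonoid S) Y Z) (by simp)
    (fun g f => ?_) (fun a b ha hb => by
      rw [Preadditive.add_comp, map_add, map_add, Preadditive.add_comp, ha, hb]) u
  rw [Orbit.homSingle_comp, orbitToSkew_homSingle, orbitToSkew_homSingle]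
  obtain ⟨W, hW⟩ | hW := AddZero.eq_of_or_eq_zero (Orbit.act φ g X.as)
  · obtain ⟨m, rfl⟩ := AddZero.exists_eq_eqToHom_comp_inclHom hW f
    rw [extendZero_comp, extendZero_eqToHom, Category.assoc]
    refine Eq.trans ?_ (congrArg (_ ≫ ·) (isSkew (t := genAct φ gen) s m Z h)).symm
    have hW' : Orbit.act φ (gen s * g) X.as = (φ (gen s)).functor.obj (.of W) := by
      rw [Orbit.act_mul, hW]
    rw [CategoryTheory.Functor.map_comp, Category.assoc, eqToHom_map, eqToHom_trans_assoc,
      extendZero_eqToHom_comp]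
    have hP : ∀ Z, wordMor (genAct φ gen) R (rep (gen s * g)) X.as Z =
        wordMor (genAct φ gen) R (rep g) X.as W ≫
          wordMor (genAct φ gen) R (FreeMonoid.of s : FreeMonoid S) W Z := fun Z => by
      rw [hmul, wordMor_mul (Y := W)]
      rw [hact]
      exact hW
    -- By `hP` the path of `rep g` is a common left factor, which can be taken out of `extendZero`.
    -- The object `U` is left arbitrary to allow `s W = 0`, when both sides vanish.
    have key : ∀ (U : AddZero (IdealQuotient k ρ)) (q : U ⟶ .of Z),
        extendZero k (oldFunctor (genAct φ gen) R)
          (wordMor (genAct φ gen) R (rep (gen s * g)) X.as) U Z q =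
        wordMor (genAct φ gen) R (rep g) X.as W ≫ extendZero k (oldFunctor (genAct φ gen) R)
          (wordMor (genAct φ gen) R (FreeMonoid.of s : FreeMonoid S) W) U Z q := by
      intro U q
      cases U with
      | of U =>
        obtain ⟨q, rfl⟩ := AddZero.exists_inclHom_eq q
        refine (congrArg (· ≫ _) (hP U)).trans (Category.assoc _ _ _)
      | zero => exact (Limits.comp_zero (C := SkewCat (genAct φ gen) R)).symm
    exact key _ _
  · rw [AddZero.eq_zero_of_source hW f, CategoryTheory.Functor.map_zero, Limits.zero_comp,
      Limits.comp_zero, map_zero, map_zero, Limits.zero_comp]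

/-- `orbitToSkew` is left inverse to the functor given by the interpretation of `Q'`. -/
lemma orbitToSkew_skewFunctor
    (hact : ∀ g, wordAct (genAct φ gen) (rep g) = φ g)
    (hone : ∀ X, wordMor (genAct φ gen) R (rep 1) X X = 𝟙 _)
    (hmul : ∀ s g X Y, wordMor (genAct φ gen) R (rep (gen s * g)) X Y =
      wordMor (genAct φ gen) R ((FreeMonoid.of s : FreeMonoid S) * rep g) X Y)
    {X Y : PathCat k (SkewQuiver (genAct φ gen))} (f : X ⟶ Y) :
    orbitToSkew φ gen R rep _ _ ((skewFunctor φ gen).map f) =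
      (skewProj (genAct φ gen) R).map f := by
  refine PathCat.hom_ind (p := fun X Y f =>
      orbitToSkew φ gen R rep _ _ ((skewFunctor φ gen).map f) =
      (skewProj (genAct φ gen) R).map f)
    (fun X Y => ?_) (fun X Y f g hf hg => ?_) (fun X Y c f hf => ?_)
    (fun x => ?_) (fun x y z f a hf => ?_) f
  · rw [CategoryTheory.Functor.map_zero, CategoryTheory.Functor.map_zero, map_zero]
    rfl
  · rw [CategoryTheory.Functor.map_add, CategoryTheory.Functor.map_add, map_add, hf, hg]
    rfl
  · rw [CategoryTheory.Functor.map_smul, CategoryTheory.Functor.map_smul, map_smul, hf]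
    rfl
  · rw [CategoryTheory.Functor.map_id, CategoryTheory.Functor.map_id, Orbit.id_eq,
      orbitToSkew_homSingle, extendZero_eqToHom]
    exact hone _
  -- Only composition with a single arrow at the end occurs, so `orbitToSkew` need not be known to
  -- be functorial.
  · rw [CategoryTheory.Functor.map_comp, CategoryTheory.Functor.map_comp, ← hf]
    match a with
    | .inl a =>
      refine (congrArg (fun m => orbitToSkew φ gen R rep _ _ ((skewFunctor φ gen).map f ≫ m))
        (skewFunctor_oldArrow φ gen a)).trans ?_
      refine (orbitToSkew_comp_ofHom φ gen R rep _ _).trans ?_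
      exact congrArg (_ ≫ ·) ((oldFunctor_map _ R _).trans
        (congrArg (skewProj (genAct φ gen) R).map (pathLift_map_arrow _ _)))
    | .inr ⟨s, h⟩ =>
      refine (congrArg (fun m => orbitToSkew φ gen R rep _ _ ((skewFunctor φ gen).map f ≫ m))
        (skewFunctor_newArrow φ gen h)).trans ?_
      refine (orbitToSkew_comp_gen φ gen hact hmul _ s h).trans ?_
      exact congrArg (_ ≫ ·) (wordMor_of _ R h)

/-- The hypothesis `hword` concerns words only, since `G` need not have a zero; a representative `0`
is controlled by `hact`. -/
lemma skewFunctor_full (hact : ∀ g, wordAct (genAct φ gen) (rep g) = φ g)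
    (hword : ∀ g (w : FreeMonoid S), rep g = w → FreeMonoid.lift gen w = g) :
    (skewFunctor φ gen).Full where
  map_surjective {X Y} a := by
    obtain ⟨x, rfl⟩ : ∃ x, X = skewVertex (genAct φ gen) x :=
      ⟨SkewQuiver.vertex (t := genAct φ gen) X, rfl⟩
    obtain ⟨y, rfl⟩ : ∃ y, Y = skewVertex (genAct φ gen) y :=
      ⟨SkewQuiver.vertex (t := genAct φ gen) Y, rfl⟩
    refine Orbit.homSingle_ind (p := fun a => ∃ b, (skewFunctor φ gen).map b = a)
      ⟨0, (skewFunctor φ gen).map_zero _ _⟩ (fun g f => ?_) ?_ a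
    · obtain ⟨W, hW⟩ | hW := AddZero.eq_of_or_eq_zero (Orbit.act φ g (presVertex ρ x))
      · obtain ⟨m, rfl⟩ := AddZero.exists_eq_eqToHom_comp_inclHom hW f
        obtain ⟨μ, rfl⟩ := (Quotient.functor (idealRel k ρ)).map_surjective (X := W.as)
          (Y := PathCat.vertex k y) m
        cases hw : rep g with
        | zero =>
          -- If `g` is represented by `0`, it acts as the zero functor, contrary to `g x` being the
          -- object `W`.
          have := hact g
          rw [hw, map_zero] at this
          rw [Orbit.act, ← this] at hW
          cases hW
        | coe w =>
          obtain rfl := hword g w hw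
          refine ⟨piWord (genAct φ gen) (w : WithZero (FreeMonoid S)) x W.as ≫
            (oldInclusion (genAct φ gen)).map μ, ?_⟩
          refine ((skewFunctor φ gen).map_comp _ _).trans ?_
          refine (congrArg₂ (· ≫ ·) (skewFunctor_piWord φ gen hW)
            (skewFunctor_oldInclusion φ gen μ)).trans ?_
          exact Orbit.homSingle_comp_ofHom _ _ _
      · refine ⟨0, ((skewFunctor φ gen).map_zero _ _).trans ?_⟩
        rw [AddZero.eq_zero_of_source hW f]
        exact (Orbit.homSingle_zero g).symm
    · rintro _ _ ⟨a, rfl⟩ ⟨b, rfl⟩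
      exact ⟨a + b, (skewFunctor φ gen).map_add⟩

/-- The orbit category and its algebra are presented by `Q'` as soon as each element of `G` is
represented by a word, or by `0`, compatibly with the relations. -/
lemma orbitPresented_of_rep
    (hR : ∀ a b, (a, b) ∈ R → ∀ x y : V,
      (skewFunctor φ gen).map (piWord (genAct φ gen) a x y) =
        (skewFunctor φ gen).map (piWord (genAct φ gen) b x y))
    (hact : ∀ g, wordAct (genAct φ gen) (rep g) = φ g)
    (hword : ∀ g (w : FreeMonoid S), rep g = w → FreeMonoid.lift gen w = g)
    (hone : ∀ X, wordMor (genAct φ gen) R (rep 1) X X = 𝟙 _)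
    (hmul : ∀ s g X Y, wordMor (genAct φ gen) R (rep (gen s * g)) X Y =
      wordMor (genAct φ gen) R ((FreeMonoid.of s : FreeMonoid S) * rep g) X Y) :
    OrbitPresented φ gen R := by
  have hobj : Function.Bijective (skewInterp φ gen).obj := by
    refine ⟨fun x y h => ?_, fun X => ⟨⟨toVertex ρ X.as⟩, rfl⟩⟩
    injection h with h
    exact congrArg (fun X => (⟨toVertex ρ X⟩ : SkewQuiver (genAct φ gen))) h
  have hker : ∀ (X Y : PathCat k (SkewQuiver (genAct φ gen))) (f : X ⟶ Y),
      (skewFunctor φ gen).map f = 0 ↔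
        f ∈ idealSpan k (fun X Y => {f | skewRel (genAct φ gen) R X Y f}) X Y := by
    refine fun X Y f => ⟨fun h => ?_, fun h => map_eq_zero_of_mem_idealSpan _
      (fun X Y f hf => skewFunctor_map_eq_zero φ gen R hR hf) h⟩
    -- The left inverse recovers the class of `f` from its image, which is `0`.
    rw [← functor_map_eq_zero_iff]
    refine (orbitToSkew_skewFunctor φ gen hact hone hmul f).symm.trans ?_
    rw [h, map_zero]
    rfl
  have hfull := skewFunctor_full φ gen hact hword
  exact ⟨isCategoryPresentation_of_kernel hobj hfull hker,
    isAlgebraPresentation_of_kernel hobj hfull hker⟩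

end Inverse

/-! ### Monoid presentations without and with zero -/

section Presented

variable {k : Type uk} [CommRing k] {V : Type u} [Quiver.{v} V]
  {ρ : MorphSet (PathCat k V)} {S : Type us}

theorem orbitPresented_of_isMonoidPresentation {G : Type ug} [Monoid G]
    (φ : G →* ZEnd k (IdealQuotient k ρ)) (gen : S → G)
    (R : Set (FreeMonoid S × FreeMonoid S)) (h : IsMonoidPresentation gen R) :
    OrbitPresented φ gen (Prod.map WithZero.coe WithZero.coe '' R) := by
  obtain ⟨hsurj, hcon⟩ := h
  choose w hw using hsurj
  have key : ∀ a b : FreeMonoid S, FreeMonoid.lift gen a = FreeMonoid.lift gen b → ∀ X Y,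
      wordMor (genAct φ gen) (Prod.map WithZero.coe WithZero.coe '' R) a X Y =
        wordMor (genAct φ gen) (Prod.map WithZero.coe WithZero.coe '' R) b X Y := by
    intro a b hab
    -- The kernel is the smallest congruence containing `R`, and `wordCon`, restricted to nonzero
    -- words, contains `R`. Hence the class of `π(w, x)` depends only on the value of `w`.
    have hle : Con.ker (FreeMonoid.lift gen) ≤
        (wordCon (genAct φ gen) (Prod.map WithZero.coe WithZero.coe '' R)).comap
          WithZero.coe (fun _ _ => WithZero.coe_mul _ _) := by
      rw [hcon, Con.conGen_le]
      intro a b hab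
      refine ⟨?_, wordMor_eq_of_mem _ ⟨(a, b), hab, rfl⟩⟩
      have : Con.ker (FreeMonoid.lift gen) a b := by
        rw [hcon]
        exact ConGen.Rel.of _ _ hab
      rw [wordAct_coe, wordAct_coe, (Con.ker_rel _).1 this]
    exact (hle ((Con.ker_rel _).2 hab)).2
  refine orbitPresented_of_rep (rep := fun g => w g) φ gen ?_ (fun g => ?_) (fun g w' hw' => ?_)
    (fun X => ?_) (fun s g X Y => ?_)
  · rintro _ _ ⟨⟨a, b⟩, hab, e⟩ x y
    obtain ⟨rfl, rfl⟩ := Prod.mk.inj e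
    refine skewFunctor_piWord_congr φ gen ?_ x y
    have : Con.ker (FreeMonoid.lift gen) a b := by
      rw [hcon]
      exact ConGen.Rel.of _ _ hab
    exact (Con.ker_rel _).1 this
  · rw [wordAct_coe, hw]
  · rw [← hw g, WithZero.coe_injective hw']
  · rw [key (w 1) 1 (by rw [hw, map_one])]
    exact wordMor_one _ _ _
  · rw [← WithZero.coe_mul]
    exact key _ _ (by rw [hw, map_mul, hw, FreeMonoid.lift_eval_of]) _ _

theorem orbitPresented_of_isMonoidWithZeroPresentation {G : Type ug} [MonoidWithZero G]
    (φ : G →*₀ ZEnd k (IdealQuotient k ρ)) (gen : S → G)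
    (R : Set (WithZero (FreeMonoid S) × WithZero (FreeMonoid S)))
    (h : IsMonoidWithZeroPresentation gen R) :
    OrbitPresented (φ : G →* ZEnd k (IdealQuotient k ρ)) gen R := by
  obtain ⟨hsurj, hcon⟩ := h
  choose w hw using hsurj
  obtain ⟨ψ, hψ⟩ : ∃ ψ : G →* ZEnd k (IdealQuotient k ρ),
    ψ = (φ : G →* ZEnd k (IdealQuotient k ρ)) := ⟨_, rfl⟩
  have hψ₀ : ψ 0 = 0 := by
    rw [hψ]
    exact map_zero φ
  rw [← hψ]
  have hact : ∀ a, wordAct (genAct ψ gen) a = ψ (WithZero.lift' (FreeMonoid.lift gen) a) := by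
    intro a
    cases a with
    | zero => rw [map_zero, map_zero]; exact hψ₀.symm
    | coe a => rw [wordAct_coe, WithZero.lift'_coe]
  have hmem : ∀ {a b}, (a, b) ∈ R → WithZero.lift' (FreeMonoid.lift gen) a =
      WithZero.lift' (FreeMonoid.lift gen) b := by
    intro a b hab
    have : Con.ker (WithZero.lift' (FreeMonoid.lift gen)) a b := by
      rw [hcon]
      exact ConGen.Rel.of _ _ hab
    exact (Con.ker_rel _).1 this
  have key : ∀ a b, WithZero.lift' (FreeMonoid.lift gen) a =
      WithZero.lift' (FreeMonoid.lift gen) b → ∀ X Y,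
      wordMor (genAct ψ gen) R a X Y = wordMor (genAct ψ gen) R b X Y := by
    intro a b hab
    have hle : Con.ker (WithZero.lift' (FreeMonoid.lift gen)) ≤ wordCon (genAct ψ gen) R := by
      rw [hcon, Con.conGen_le]
      intro a b hab
      exact ⟨by rw [hact, hact, hmem hab], wordMor_eq_of_mem _ hab⟩
    exact (hle ((Con.ker_rel _).2 hab)).2
  -- A word of value `0` acts as the zero functor, so its path vanishes in `k[Q']` itself. This
  -- settles the relations that equate a word with `0`.
  have hzero : ∀ a, WithZero.lift' (FreeMonoid.lift gen) a = 0 → ∀ x y,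
      piWord (genAct ψ gen) a x y = 0 := by
    intro a ha x y
    apply piWord_eq_zero
    rw [hact, ha, hψ₀]
    exact fun h => by cases h
  refine orbitPresented_of_rep (rep := w) ψ gen (fun a b hab x y => ?_) (fun g => ?_)
    (fun g w' hw' => ?_) (fun X => ?_) (fun s g X Y => ?_)
  · have e := hmem hab
    cases a with
    | zero => rw [hzero b (by rw [← e, map_zero]), piWord_zero]
    | coe a =>
      cases b with
      | zero => rw [hzero a (by rw [e, map_zero]), piWord_zero]
      | coe b => exact skewFunctor_piWord_congr ψ gen e x y
  · rw [hact, hw]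
  · rw [← hw g, hw', WithZero.lift'_coe]
  · rw [key (w 1) 1 (by rw [hw, map_one])]
    exact wordMor_one _ _ _
  · exact key _ _ (by rw [hw, map_mul, hw, WithZero.lift'_coe, FreeMonoid.lift_eval_of]) _ _

end Presented

end

end SkewMonoid

theorem mainTheorem11 {k : Type uk} [Field k] {V : Type u} [Quiver.{v} V]
    (hV : IsLocallyFinite V) (ρ : MorphSet (PathCat k V))
    (hρ : ∀ X Y : PathCat k V, ρ X Y ⊆ arrowIdealSq k V X Y) :
    (∀ (G : Type ug) [Monoid G] (φ : G →* LinEnd k (IdealQuotient k ρ)),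
      Function.Injective φ →
      ∀ (S : Type us) (gen : S → G) (R : Set (FreeMonoid S × FreeMonoid S)),
        IsMonoidPresentation gen R →
        OrbitPresented ((LinEnd.toZEnd k (IdealQuotient k ρ)).comp φ) gen
          (Prod.map WithZero.coe WithZero.coe '' R)) ∧
    (∀ (G : Type ug) [MonoidWithZero G] (φ : G →*₀ ZEnd k (IdealQuotient k ρ)),
      Function.Injective φ →
      ∀ (S : Type us) (gen : S → G)
        (R : Set (WithZero (FreeMonoid S) × WithZero (FreeMonoid S))),
        IsMonoidWithZeroPresentation gen R →
        OrbitPresented (φ : G →* ZEnd k (IdealQuotient k ρ)) gen R) := by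
  exact ⟨fun G _ φ _ S gen R h => orbitPresented_of_isMonoidPresentation _ gen R h,
    fun G _ φ _ S gen R h => orbitPresented_of_isMonoidWithZeroPresentation φ gen R h⟩
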